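/- **Theorem 1.2.** Let $p$ be an odd prime, $m\ge 1$, and let $\chi$ be a primitive Dirichlet character modulo $p^m$ with values in $\mathbb{C}$. Let $n$ and $q$ be positive integers with $p\nmid q$, and let $k\ge 0$ be an integer of opposite parity to $\chi$, i.e. $\chi(-1)\ne(-1)^k$. Let $L(s,\chi)$ be the (analytically continued) Dirichlet $L$-function and $\phi$ the Euler totient function. For algebraic numbers $x,y$ and an integer $N\ge 0$ write $x\equiv y\pmod{p^N}$ if $(x-y)/p^N$ is $p$-integral, i.e. if $s(x-y)/p^N$ is an algebraic integer for some integer $s\geq 1$ with $p\nmid s$. An algebraic integer $x$ is called prime to $p$ if $x$ and $p$ generate the unit ideal in the ring of algebraic integers. (i) Suppose that $1-\chi(a)a^{k+1}$ is prime to $p$ for some integer $a$ with $p\nmid a$. Then $$L(-k-\phi(p^n)q,\chi)\equiv L(-k,\chi)\pmod{p^n}.$$ (ii) Suppose that $m\ge 2$ and that $1-\chi(a)a^{k+1}$ is not prime to $p$ for every integer $a$ with $p\nmid a$. For $l\ge 0$ put $\mathcal{L}_{l,\chi}=(1-\chi(p+1))\,L(-l,\chi)$. Then $$\mathcal{L}_{k+\phi(p^n)q,\chi}-\mathcal{L}_{k,\chi}\equiv\frac{p^nq}{1-\overline{\chi}(p+1)}\cdot\mathcal{L}_{d,\chi}\pmod{p^n},$$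 where $d\in\{0,1,\dots,p-2\}$ with $d\equiv k\pmod{p-1}$. In particular, for every integer $N\ge 0$ and every integer $h$ with $k+(p-1)h\ge 0$, $$\mathcal{L}_{k+(p-1)h,\chi}\equiv\mathcal{L}_{k,\chi}\pmod{p^{N}}\quad\text{if and only if}\quad p^{N}\mid h.$$ -/

import Mathlib

/-- A complex number `z` is `p`-integral if some integer multiple `s * z` with `p ∤ s`
is an algebraic integer (in other words, `z` is an algebraic number that is integral at every
prime lying above `p`). -/
def PIntegral (p : ℕ) (z : ℂ) : Prop :=
  ∃ s : ℕ, ¬ p ∣ s ∧ IsIntegral ℤ ((s : ℂ) * z)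

/-- The congruence `x ≡ y (mod p ^ n)` between algebraic numbers: `(x - y) / p ^ n` is
`p`-integral. -/
def CongrModPow (p n : ℕ) (x y : ℂ) : Prop :=
  PIntegral p ((x - y) / (p : ℂ) ^ n)

/-- The algebraic integer `x` is prime to `p`: in the ring of all algebraic integers, `x` and
`p` generate the unit ideal. -/
def PrimeTo (p : ℕ) (x : ℂ) : Prop :=
  IsIntegral ℤ x ∧
    ∃ u v : ℂ, IsIntegral ℤ u ∧ IsIntegral ℤ v ∧ u * x + v * (p : ℂ) = 1

/-- The value `L(-k, χ)` of the (analytically continued) Dirichlet `L`-function. -/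
noncomputable def LNeg {N : ℕ} [NeZero N] (χ : DirichletCharacter ℂ N) (k : ℕ) : ℂ :=
  DirichletCharacter.LFunction χ (-(k : ℂ))

/-- `𝓛_{k, χ} = (1 - χ(p + 1)) L(-k, χ)`, for a character `χ` modulo `p ^ m`, `p` odd. -/
noncomputable def scriptL (p m : ℕ) [NeZero (p ^ m)] (χ : DirichletCharacter ℂ (p ^ m))
    (k : ℕ) : ℂ :=
  (1 - χ ((p + 1 : ℕ) : ZMod (p ^ m))) * LNeg χ k

/-! Let 𝒪 be the ring of `p`-integral numbers and E_k(c) = (1 - χ(c)c^(k+1)) L(-k, χ) for `p ∤ c`.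
The Bernoulli formula for L(-k, χ) makes it the `p`-adic limit of normalized sums of χ(a)a^(k+1)
over a < p^M. Permuting the residues by a ↦ ca mod p^M and expanding to second order (Voronoi)
exhibits E_k(c) as the limit of the sums of χ(cx)(cx)^k ⌊cx/p^M⌋. Only the values a^k with `p ∤ a`
matter there, so E_k(c) ≡ E_l(c) mod p^n as soon as a^k ≡ a^l mod p^n for all such a. In case (i)
the Euler factor is a unit of 𝒪, since `p` lies in the Jacobson radical, and dividing by it gives
Kummer's congruence.

In case (ii) take c = 1 + p, ζ = χ(1 + p) and π = 1 - ζ. Primitivity and p ≥ 3 give π² ∣ p, so the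
Euler factor is π times a unit congruent to 1 mod π, and 𝓛_k is E_k divided by that unit. Replacing
k by k + φ(p^n)q moves E_k only by a multiple of p^n, but moves the unit by order p^n/π, because (1
+ p)^(φ(p^n)q) = 1 - p^n q + ⋯; this is the main term (`exists_scriptL_sub_scriptL`).

The equivalence needs in addition π ∤ E_k (`regularizedL_ne_one_sub_mul`). The hypothesis yields a
residue field of characteristic `p` in which χ(a)a^(k+1) = 1 for all units a; there the Voronoi sum
becomes the sum of x⁻¹ ⌊(1+p)x/p^M⌋, which is -1. -/

/-! ### L-values at non-positive integers. -/

open Filter Asymptotics Topology in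
/-- The value at `0` of the `L`-function of a function on `ZMod N` with vanishing sum. -/
lemma ZMod.LFunction_zero_of_sum_eq_zero {N : ℕ} [NeZero N] (Φ : ZMod N → ℂ)
    (hΦ0 : Φ 0 = 0) (hΦ : ∑ j, Φ j = 0) :
    ZMod.LFunction Φ 0 = -(∑ j, Φ j * (j.val : ℂ)) / N := by
  have hN : (0 : ℝ) < N := by exact_mod_cast Nat.pos_of_ne_zero (NeZero.ne N)
  set D : ℝ → ℂ := fun t => 1 - Complex.exp (-(N * t : ℂ)) with hD
  set F : ℝ → ℂ := fun t => (∑ j : ZMod N, Φ j * Complex.exp (-(j.val * t : ℂ))) / D t with hF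
  -- `F0` is the limit of `F` at 0⁺, finite because Φ has sum zero. Subtracting it on (0, 1] makes
  -- `G` = O(t) there, so the Mellin transform of `G` is analytic on Re s > -1, and Γ(s+1)L(Φ, s) =
  -- F0 + s · mellin G s can be evaluated at s = 0.
  set F0 : ℂ := -(∑ j, Φ j * (j.val : ℂ)) / N with hF0
  set G : ℝ → ℂ := fun t => F t - (Set.Ioc (0:ℝ) 1).indicator (fun _ => F0) t with hG
  have hnorm (t : ℝ) : ‖Complex.exp (-(N * t : ℂ))‖ = Real.exp (-(N * t)) := by
    rw [Complex.norm_exp]; simp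
  have hDne : ∀ t : ℝ, 0 < t → D t ≠ 0 := by
    intro t ht h
    have h1 : Complex.exp (-(N * t : ℂ)) = 1 := by
      rw [hD] at h; exact (sub_eq_zero.mp h).symm
    have h2 := hnorm t
    rw [h1, norm_one] at h2
    have : Real.exp (-(N * t)) < 1 := by rw [Real.exp_lt_one_iff]; nlinarith
    linarith
  have hFcont : ContinuousOn F (Set.Ioi 0) := by
    refine ContinuousOn.div ?_ ?_ (fun t ht => hDne t ht)
    · fun_prop
    · fun_prop
  have hFloc : MeasureTheory.LocallyIntegrableOn F (Set.Ioi 0) :=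
    hFcont.locallyIntegrableOn measurableSet_Ioi
  have hGloc : MeasureTheory.LocallyIntegrableOn G (Set.Ioi 0) := by
    refine hFloc.sub ?_
    refine MeasureTheory.LocallyIntegrable.locallyIntegrableOn ?_ _
    exact (MeasureTheory.locallyIntegrable_const F0).indicator measurableSet_Ioc
  have hFtop (a : ℝ) : F =O[atTop] fun t : ℝ => t ^ (-a) := by
    have h1 : (fun t : ℝ => ∑ j : ZMod N, Φ j * Complex.exp (-(j.val * t : ℂ)))
        =O[atTop] fun t : ℝ => t ^ (-a) := by
      refine IsBigO.fun_sum fun j _ => ?_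
      rcases eq_or_ne j 0 with rfl | hj
      · simp only [hΦ0, zero_mul]; exact isBigO_zero _ _
      have hj' : (0:ℝ) < j.val := by
        exact_mod_cast Nat.pos_of_ne_zero (by rwa [ne_eq, ZMod.val_eq_zero])
      refine IsBigO.const_mul_left ?_ _
      rw [← isBigO_norm_left]
      refine ((isLittleO_exp_neg_mul_rpow_atTop hj' (-a)).isBigO).congr_left ?_
      intro t; rw [Complex.norm_exp]; simp [-ZMod.natCast_val]
    have h2 : (fun t : ℝ => (D t)⁻¹) =O[atTop] fun _ : ℝ => (1:ℝ) := by
      have : Tendsto D atTop (𝓝 (1 - 0)) := by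
        refine tendsto_const_nhds.sub ?_
        rw [tendsto_zero_iff_norm_tendsto_zero]
        simp_rw [hnorm]
        refine Real.tendsto_exp_neg_atTop_nhds_zero.comp ?_
        exact tendsto_id.const_mul_atTop hN
      rw [sub_zero] at this
      exact (this.inv₀ one_ne_zero).isBigO_one ℝ
    have := h1.mul h2
    simpa only [hF, div_eq_mul_inv, mul_one] using this
  have hGtop (a : ℝ) : G =O[atTop] fun t : ℝ => t ^ (-a) := by
    refine (hFtop a).congr' ?_ EventuallyEq.rfl
    filter_upwards [eventually_gt_atTop 1] with t ht
    simp [hG, Set.indicator, not_le.mpr ht]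
  have hexp (c : ℂ) : (fun t : ℝ => Complex.exp (-(c * t : ℂ)) - 1 + c * t)
      =O[𝓝[>] 0] fun t : ℝ => t ^ (2:ℝ) := by
    have hsm : ∀ᶠ t : ℝ in 𝓝[>] 0, ‖-(c * t : ℂ)‖ ≤ 1 := by
      refine (Filter.Tendsto.eventually_le_const (u := 1) (v := 0) one_pos ?_)
      have : Tendsto (fun t : ℝ => ‖-(c * t : ℂ)‖) (𝓝 0) (𝓝 ‖-(c * ((0:ℝ) : ℂ))‖) := by
        apply Continuous.tendsto; fun_prop
      simp only [Complex.ofReal_zero, mul_zero, neg_zero, norm_zero] at this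
      exact this.mono_left nhdsWithin_le_nhds
    refine IsBigO.of_bound (‖c‖ ^ 2) ?_
    filter_upwards [hsm, self_mem_nhdsWithin] with t ht ht0
    have := Complex.norm_exp_sub_one_sub_id_le ht
    rw [sub_neg_eq_add] at this
    refine this.trans (le_of_eq ?_)
    rw [norm_neg, norm_mul, mul_pow]
    congr 1
    simp [abs_of_pos (show (0:ℝ) < t from ht0)]
  have hGzero : G =O[𝓝[>] 0] fun t : ℝ => t ^ (-(-1 : ℝ)) := by
    have h1 : (fun t : ℝ => (∑ j : ZMod N, Φ j * (Complex.exp (-(j.val * t : ℂ)) - 1 + j.val * t))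
        + F0 * (Complex.exp (-((N:ℂ) * t : ℂ)) - 1 + N * t)) =O[𝓝[>] 0]
          fun t : ℝ => t ^ (2:ℝ) := by
      refine IsBigO.add (IsBigO.fun_sum fun j _ => ?_) ?_
      · exact (hexp j.val).const_mul_left _
      · exact (hexp N).const_mul_left _
    have h2 : (fun t : ℝ => (D t)⁻¹) =O[𝓝[>] 0] fun t : ℝ => t ^ (-1:ℝ) := by
      refine IsBigO.of_bound 2 ?_
      filter_upwards [Ioo_mem_nhdsGT (show (0:ℝ) < 1 by norm_num)] with t ht
      have h3 : t / 2 ≤ ‖D t‖ := by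
        have h4 : 1 - Real.exp (-(N * t)) ≤ ‖D t‖ := by
          rw [← hnorm]
          have := norm_sub_norm_le (1:ℂ) (Complex.exp (-(N * t : ℂ)))
          rwa [norm_one] at this
        refine le_trans ?_ h4
        have hN1 : (1:ℝ) ≤ N := by exact_mod_cast Nat.pos_of_ne_zero (NeZero.ne N)
        have h5 : Real.exp (-(N * t)) ≤ Real.exp (-t) := by
          apply Real.exp_le_exp.mpr; nlinarith [ht.1]
        have h6 : Real.exp (-t) * Real.exp t = 1 := by rw [← Real.exp_add]; simp
        have h7 := Real.add_one_le_exp t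
        have h8 := Real.exp_pos (-t)
        nlinarith [ht.1, ht.2]
      rw [norm_inv, Real.norm_of_nonneg (Real.rpow_nonneg ht.1.le _), Real.rpow_neg_one]
      have ht0 := ht.1
      calc ‖D t‖⁻¹ ≤ (t / 2)⁻¹ := inv_anti₀ (by positivity) h3
        _ = 2 * t⁻¹ := by field_simp
    have h3 := h1.mul h2
    refine h3.congr' ?_ ?_
    · filter_upwards [Ioc_mem_nhdsGT (show (0:ℝ) < 1 by norm_num)] with t ht
      have hDt := hDne t ht.1
      rw [hG]
      simp only [Set.indicator_of_mem ht, hF]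
      rw [eq_sub_iff_add_eq, eq_div_iff hDt, add_mul, inv_mul_cancel_right₀ hDt]
      have e1 : ∑ j : ZMod N, Φ j * (Complex.exp (-(j.val * t : ℂ)) - 1 + j.val * t)
          = ∑ j : ZMod N, Φ j * Complex.exp (-(j.val * t : ℂ)) - ∑ j, Φ j
            + (∑ j, Φ j * (j.val : ℂ)) * t := by
        rw [Finset.sum_mul, ← Finset.sum_sub_distrib, ← Finset.sum_add_distrib]
        exact Finset.sum_congr rfl fun j _ => by ring
      have e2 : F0 * N = -(∑ j, Φ j * (j.val : ℂ)) := by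
        rw [hF0, div_mul_cancel₀]; exact_mod_cast NeZero.ne N
      rw [e1, hΦ, hD]
      linear_combination (t : ℂ) * e2
    · filter_upwards [self_mem_nhdsWithin] with t ht
      rw [← Real.rpow_add ht]; norm_num
  have hmel (s : ℂ) (hs : 1 < s.re) :
      Complex.Gamma s * ZMod.LFunction Φ s = mellin F s := by
    have hs0 : 0 < s.re := by linarith
    have hbase : ∀ t ∈ Set.Ioi (0:ℝ),
        HasSum (fun n : ℕ => Φ n * (Real.exp (-(n:ℝ) * t) : ℂ)) (F t) := by
      intro t ht
      have ht : 0 < t := ht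
      have hr : ‖Complex.exp (-(N * t : ℂ))‖ < 1 := by
        rw [hnorm, Real.exp_lt_one_iff]; nlinarith
      have hsum : Summable (fun n : ℕ => Φ n * (Real.exp (-(n:ℝ) * t) : ℂ)) := by
        obtain ⟨C, hC⟩ : ∃ C, ∀ j, ‖Φ j‖ ≤ C := by
          obtain ⟨C, hC⟩ := (Set.finite_range fun j => ‖Φ j‖).bddAbove
          exact ⟨C, fun j => hC ⟨j, rfl⟩⟩
        refine Summable.of_norm_bounded (g := fun n : ℕ => C * (Real.exp (-t)) ^ n) ?_ ?_
        · refine (summable_geometric_of_lt_one (Real.exp_pos _).le ?_).mul_left C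
          rw [Real.exp_lt_one_iff]; linarith
        · intro n
          rw [norm_mul, Complex.norm_real, Real.norm_of_nonneg (Real.exp_pos _).le,
            ← Real.exp_nat_mul]
          rw [show -(n:ℝ) * t = n * -t by ring]
          exact mul_le_mul_of_nonneg_right (hC _) (Real.exp_pos _).le
      have hval : ∑' n : ℕ, Φ n * (Real.exp (-(n:ℝ) * t) : ℂ) = F t := by
        rw [Nat.sumByResidueClasses hsum N, hF]
        simp only [Finset.sum_div]
        refine Finset.sum_congr rfl fun j _ => ?_
        have : ∀ i : ℕ, Φ ((j.val + N * i : ℕ) : ZMod N)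
              * (Real.exp (-((j.val + N * i : ℕ):ℝ) * t) : ℂ)
            = Φ j * Complex.exp (-(j.val * t : ℂ)) * Complex.exp (-(N * t : ℂ)) ^ i := by
          intro i
          have : ((j.val + N * i : ℕ) : ZMod N) = j := by simp
          rw [this, mul_assoc, ← Complex.exp_nat_mul, ← Complex.exp_add]
          push_cast
          congr 2; ring
        simp_rw [this]
        rw [tsum_mul_left, tsum_geometric_of_norm_lt_one hr, hD, div_eq_mul_inv]
      rw [← hval]; exact hsum.hasSum
    have hS := LSeriesSummable_of_bounded_of_one_lt_re (f := fun n : ℕ => Φ n)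
      (m := ∑ j, ‖Φ j‖) (fun n _ => Finset.single_le_sum (f := fun j => ‖Φ j‖)
        (fun _ _ => norm_nonneg _) (Finset.mem_univ _)) hs
    have hterm (n : ℕ) : LSeries.term (fun n : ℕ => Φ n) s n = Φ n / ((n:ℝ) : ℂ) ^ s := by
      rcases eq_or_ne n 0 with rfl | hn
      · simp [hΦ0]
      · rw [LSeries.term_of_ne_zero hn]; simp
    have h := hasSum_mellin (a := fun n : ℕ => Φ n) (p := fun n : ℕ => (n:ℝ)) (F := F) (s := s)
      (fun n => by
        rcases eq_or_ne n 0 with rfl | hn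
        · left; simp [hΦ0]
        · right; exact_mod_cast Nat.pos_of_ne_zero hn) hs0 hbase (by
        refine hS.norm.congr fun n => ?_
        rw [hterm, norm_div]
        rcases eq_or_ne n 0 with rfl | hn
        · simp [hΦ0]
        · rw [Complex.norm_cpow_eq_rpow_re_of_pos (by exact_mod_cast Nat.pos_of_ne_zero hn)])
    rw [← h.tsum_eq, ZMod.LFunction_eq_LSeries Φ hs, LSeries, ← tsum_mul_left]
    refine tsum_congr fun n => ?_
    rw [hterm, mul_div_assoc]
  have hmelG (s : ℂ) (hs : 1 < s.re) : mellin F s = F0 / s + mellin G s := by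
    have hs0 : 0 < s.re := by linarith
    have hGc : MellinConvergent G s :=
      mellinConvergent_of_isBigO_rpow hGloc (hGtop (s.re + 1)) (by linarith) hGzero (by linarith)
    have hI : HasMellin (fun t => (Set.Ioc (0:ℝ) 1).indicator (fun _ => F0) t) s (F0 / s) := by
      have := hasMellin_one_Ioc hs0
      have h2 : (fun t : ℝ => (Set.Ioc (0:ℝ) 1).indicator (fun _ => F0) t)
          = fun t => F0 • (Set.Ioc (0:ℝ) 1).indicator (fun _ => (1:ℂ)) t := by
        ext t; simp [Set.indicator]
      rw [h2]
      refine ⟨this.1.const_smul F0, ?_⟩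
      rw [mellin_const_smul, this.2, smul_eq_mul, mul_one_div]
    have := hasMellin_add hI.1 hGc
    rw [hI.2] at this
    rw [← this.2]
    congr 1
    ext t; simp [hG]
  have hLd : Differentiable ℂ (ZMod.LFunction Φ) :=
    ZMod.differentiable_LFunction_of_sum_zero hΦ
  set U : Set ℂ := {s | -1 < s.re} with hU
  have hUo : IsOpen U := isOpen_lt continuous_const Complex.continuous_re
  have hA1 : AnalyticOnNhd ℂ (fun s => Complex.Gamma (s + 1) * ZMod.LFunction Φ s) U := by
    refine DifferentiableOn.analyticOnNhd (fun s hs => ?_) hUo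
    refine DifferentiableAt.differentiableWithinAt (DifferentiableAt.mul ?_ (hLd s))
    refine DifferentiableAt.comp s (Complex.differentiableAt_Gamma _ fun m h => ?_) (by fun_prop)
    have := congrArg Complex.re h
    simp only [Complex.add_re, Complex.one_re, Complex.neg_re, Complex.natCast_re] at this
    have hs' : -1 < s.re := hs
    have : (0:ℝ) ≤ m := Nat.cast_nonneg m
    linarith
  have hA2 : AnalyticOnNhd ℂ (fun s => F0 + s * mellin G s) U := by
    refine DifferentiableOn.analyticOnNhd (fun s hs => ?_) hUo
    refine DifferentiableAt.differentiableWithinAt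
      (DifferentiableAt.const_add _ (DifferentiableAt.mul differentiableAt_id ?_))
    exact mellin_differentiableAt_of_isBigO_rpow hGloc (hGtop (s.re + 1)) (by linarith) hGzero hs
  have hUp : IsPreconnected U := by
    refine Convex.isPreconnected ?_
    exact convex_halfSpace_re_gt (-1)
  have heq := hA1.eqOn_of_preconnected_of_eventuallyEq hA2 hUp (z₀ := 2) (by simp [hU]; norm_num)
    (by
      have : {s : ℂ | 1 < s.re} ∈ 𝓝 (2:ℂ) :=
        (isOpen_lt continuous_const Complex.continuous_re).mem_nhds (by simp)
      filter_upwards [this] with s hs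
      have hs : 1 < s.re := hs
      have hs0 : s ≠ 0 := by
        rintro rfl; simp at hs; linarith
      rw [Complex.Gamma_add_one s hs0, mul_assoc, hmel s hs, hmelG s hs]
      field_simp)
  have := heq (x := 0) (by simp [hU])
  simpa using this

/-- The values of a nontrivial Dirichlet `L`-function at non-positive integers, in terms of
Bernoulli polynomials. -/
lemma LNeg_eq_sum_bernoulli {N : ℕ} [NeZero N] (χ : DirichletCharacter ℂ N) (hχ : χ ≠ 1) (k : ℕ) :
    LNeg χ k = -((N : ℂ) ^ k / (k + 1)) * ∑ j : ZMod N, χ j *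
      (((Polynomial.bernoulli (k + 1)).eval ((j.val : ℚ) / N) : ℚ) : ℂ) := by
  have hsum : ∑ j : ZMod N, χ j = 0 := MulChar.sum_eq_zero_of_ne_one hχ
  rcases eq_or_ne k 0 with rfl | hk
  · have hχ0 : χ 0 = 0 := by
      refine χ.map_nonunit fun h => ?_
      have : Subsingleton (ZMod N) := by
        rw [isUnit_zero_iff] at h
        exact subsingleton_of_zero_eq_one h
      exact hχ (MulChar.ext fun a => by rw [Subsingleton.elim (a : ZMod N) 1]; simp)
    have := ZMod.LFunction_zero_of_sum_eq_zero (fun j => χ j) hχ0 hsum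
    rw [LNeg, DirichletCharacter.LFunction]
    simp only [Nat.cast_zero, neg_zero, zero_add, pow_zero, div_one]
    rw [this, Polynomial.bernoulli_one]
    simp only [Polynomial.eval_sub, Polynomial.eval_X, Polynomial.eval_C]
    push_cast
    simp_rw [mul_sub]
    rw [Finset.sum_sub_distrib, ← Finset.sum_mul, hsum]
    simp_rw [← mul_div_assoc]
    rw [← Finset.sum_div]
    ring
  · rw [LNeg, DirichletCharacter.LFunction, ZMod.LFunction, neg_neg, Complex.cpow_natCast,
      neg_mul, div_mul_eq_mul_div, ← neg_div, neg_mul_eq_mul_neg, mul_div_assoc]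
    congr 1
    rw [← Finset.sum_neg_distrib, Finset.sum_div]
    refine Finset.sum_congr rfl fun j _ => ?_
    have hj : ((j.val : ℝ) / N) ∈ Set.Icc (0:ℝ) 1 := by
      have : (0:ℝ) < N := by exact_mod_cast Nat.pos_of_ne_zero (NeZero.ne N)
      refine ⟨by positivity, ?_⟩
      rw [div_le_one this]
      exact_mod_cast j.val_lt.le
    rw [ZMod.toAddCircle_apply, HurwitzZeta.hurwitzZeta_neg_nat hk hj]
    have : (((j.val : ℝ) / N : ℝ) : ℂ) = algebraMap ℚ ℂ ((j.val : ℚ) / N) := by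
      simp [-ZMod.natCast_val]
    rw [this, Polynomial.eval_map_algebraMap, Polynomial.aeval_algebraMap_apply]
    simp only [eq_ratCast, Polynomial.coe_aeval_eq_eval]
    ring

/-! ### The ring 𝒪 of `p`-integral numbers and its Jacobson radical. -/

/-- The subring of `p`-integral complex numbers. -/
def pIntegralSubring (p : ℕ) [hp : Fact p.Prime] : Subring ℂ where
  carrier := {z | PIntegral p z}
  mul_mem' := by
    rintro a b ⟨s, hs, ha⟩ ⟨t, ht, hb⟩
    refine ⟨s * t, fun h => (hp.out.dvd_mul.mp h).elim hs ht, ?_⟩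
    rw [show ((s * t : ℕ) : ℂ) * (a * b) = (s * a) * (t * b) by push_cast; ring]
    exact ha.mul hb
  one_mem' := ⟨1, fun h => hp.out.one_lt.ne' (Nat.dvd_one.mp h), by simpa using isIntegral_one⟩
  add_mem' := by
    rintro a b ⟨s, hs, ha⟩ ⟨t, ht, hb⟩
    refine ⟨s * t, fun h => (hp.out.dvd_mul.mp h).elim hs ht, ?_⟩
    have h1 : IsIntegral ℤ (t : ℂ) := isIntegral_algebraMap (x := (t : ℤ))
    have h2 : IsIntegral ℤ (s : ℂ) := isIntegral_algebraMap (x := (s : ℤ))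
    rw [show ((s * t : ℕ) : ℂ) * (a + b) = t * (s * a) + s * (t * b) by push_cast; ring]
    exact (h1.mul ha).add (h2.mul hb)
  zero_mem' := ⟨1, fun h => hp.out.one_lt.ne' (Nat.dvd_one.mp h), by simpa using isIntegral_zero⟩
  neg_mem' := by
    rintro a ⟨s, hs, ha⟩
    refine ⟨s, hs, ?_⟩
    rw [mul_neg]; exact ha.neg

section PIntegralSubring

variable {p : ℕ} [hp : Fact p.Prime]

local notation "𝒪" => pIntegralSubring p

lemma IsIntegral.mem_pIntegralSubring {z : ℂ} (h : IsIntegral ℤ z) : z ∈ 𝒪 :=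
  ⟨1, fun h => hp.out.one_lt.ne' (Nat.dvd_one.mp h), by simpa using h⟩

lemma inv_intCast_mem_pIntegralSubring {a : ℤ} (ha : ¬ (p : ℤ) ∣ a) : (a : ℂ)⁻¹ ∈ 𝒪 := by
  have ha0 : (a : ℂ) ≠ 0 := by
    rintro h; exact ha (by rw [Int.cast_eq_zero.mp h]; exact dvd_zero _)
  refine ⟨a.natAbs, fun h => ha (Int.natCast_dvd.mpr h), ?_⟩
  have : ((a.natAbs : ℕ) : ℂ) = ((a.natAbs : ℤ) : ℂ) := by simp
  rw [this]
  rcases Int.natAbs_eq a with h | h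
  · rw [← h, mul_inv_cancel₀ ha0]; exact isIntegral_one
  · rw [show (a.natAbs : ℤ) = -a by omega, Int.cast_neg, neg_mul, mul_inv_cancel₀ ha0]
    exact isIntegral_one.neg

/-- This says that `p` is in the Jacobson radical of 𝒪. If st is an algebraic integer with monic
equation f, then scaling the roots of f by `p` gives g with root pst and g(s) ≡ s^deg mod `p`. So
g(s) is an integer prime to `p`, and it is divisible by g's linear factor s - pst = s(1 - pt). -/
lemma exists_mul_eq_one_of_one_sub_prime_mul {t : ℂ} (ht : t ∈ 𝒪) :
    ∃ u ∈ 𝒪, (1 - p * t) * u = 1 := by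
  obtain ⟨s, hs, ha⟩ := ht
  obtain ⟨f, hf, hfa⟩ := id ha
  set g := f.scaleRoots (p : ℤ) with hg
  have hga : Polynomial.aeval ((p : ℂ) * (s * t)) g = 0 := by
    have := Polynomial.scaleRoots_aeval_eq_zero (r := (p : ℤ)) hfa
    simpa using this
  set G : ℤ := g.eval (s : ℤ) with hG
  have hGp : ¬ (p : ℤ) ∣ G := by
    intro h
    have h1 : ((G : ℤ) : ZMod p) = 0 := (ZMod.intCast_zmod_eq_zero_iff_dvd G p).mpr h
    have h2 : ((G : ℤ) : ZMod p) = (s : ZMod p) ^ f.natDegree := by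
      have e1 : ((G : ℤ) : ZMod p) = (g.map (Int.castRingHom (ZMod p))).eval (s : ZMod p) := by
        rw [hG]; simp [Polynomial.eval_natCast_map]
      rw [e1, hg, Polynomial.map_scaleRoots _ _ _ (by simp [hf.leadingCoeff])]
      simp [hf.map, hf.natDegree_map]
    rw [h2] at h1
    have := eq_zero_of_pow_eq_zero h1
    exact hs ((ZMod.natCast_eq_zero_iff s p).mp this)
  have hsI : IsIntegral ℤ (s : ℂ) := isIntegral_algebraMap (x := (s : ℤ))
  let A := integralClosure ℤ ℂ
  let aA : A := ⟨(s : ℂ) * t, ha⟩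
  obtain ⟨w, hw⟩ := Polynomial.sub_dvd_eval_sub (s : A) (p * aA) (g.map (algebraMap ℤ A))
  have hw' : (G : ℂ) = (s - p * (s * t)) * (w : ℂ) := by
    have h1 := congrArg (algebraMap A ℂ) hw
    have e2 : algebraMap A ℂ ((g.map (algebraMap ℤ A)).eval (p * aA)) = 0 := by
      rw [Polynomial.eval_map_algebraMap, ← Polynomial.aeval_algebraMap_apply]
      exact hga
    have e3 : algebraMap A ℂ ((g.map (algebraMap ℤ A)).eval (s : A)) = G := by
      rw [Polynomial.eval_map_algebraMap, ← Polynomial.aeval_algebraMap_apply, hG]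
      have := Polynomial.aeval_algebraMap_apply ℂ (s : ℤ) g
      simpa using this
    rw [map_sub, e2, e3, sub_zero] at h1
    rw [h1]
    simp [aA]
  have hG0 : (G : ℂ) ≠ 0 := by
    rintro h; exact hGp (by rw [Int.cast_eq_zero.mp h]; exact dvd_zero _)
  refine ⟨s * w * (G : ℂ)⁻¹, mul_mem (mul_mem hsI.mem_pIntegralSubring
    (IsIntegral.mem_pIntegralSubring w.2)) (inv_intCast_mem_pIntegralSubring hGp), ?_⟩
  field_simp
  rw [hw']; ring

/-- An element with a power divisible by `p` lies in the Jacobson radical. -/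
lemma exists_mul_eq_one_of_pow_eq_prime_mul {x y t : ℂ} {M : ℕ} (hx : x ∈ 𝒪) (hy : y ∈ 𝒪)
    (ht : t ∈ 𝒪) (h : x ^ M = p * y) : ∃ u ∈ 𝒪, (1 - x * t) * u = 1 := by
  obtain ⟨u, hu, hu1⟩ := exists_mul_eq_one_of_one_sub_prime_mul
    (mul_mem hy (pow_mem ht M))
  refine ⟨(∑ i ∈ Finset.range M, (x * t) ^ i) * u, mul_mem (sum_mem fun i _ =>
    pow_mem (mul_mem hx ht) i) hu, ?_⟩
  rw [← mul_assoc, mul_neg_geom_sum, mul_pow, h, mul_assoc (p : ℂ), hu1]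

lemma PrimeTo.exists_mul_eq_one {x : ℂ} (hx : PrimeTo p x) : ∃ u ∈ 𝒪, x * u = 1 := by
  obtain ⟨-, u, v, hu, hv, h⟩ := hx
  obtain ⟨w, hw, hw1⟩ := exists_mul_eq_one_of_one_sub_prime_mul (p := p) hv.mem_pIntegralSubring
  refine ⟨u * w, mul_mem hu.mem_pIntegralSubring hw, ?_⟩
  rw [← hw1]
  linear_combination w * h

/-- The bound on the `p`-part of the denominator is uniform in `T`, which makes the quadratic error
in Faulhaber's formula `p`-adically negligible. -/
lemma exists_pow_mul_eval_mem_pIntegralSubring (R : Polynomial ℚ) :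
    ∃ e : ℕ, ∀ T : ℕ, (p : ℂ) ^ e * ((R.eval (T : ℚ) : ℚ) : ℂ) ∈ 𝒪 := by
  induction R using Polynomial.induction_on' with
  | add P Q hP hQ =>
    obtain ⟨e, he⟩ := hP
    obtain ⟨e', he'⟩ := hQ
    refine ⟨e + e', fun T => ?_⟩
    have h1 := mul_mem (pow_mem (natCast_mem 𝒪 p) e') (he T)
    have h2 := mul_mem (pow_mem (natCast_mem 𝒪 p) e) (he' T)
    convert add_mem h1 h2 using 1
    rw [Polynomial.eval_add]; push_cast; ring
  | monomial n a =>
    obtain ⟨e, s, hs, hd⟩ := Nat.exists_eq_pow_mul_and_not_dvd a.den_nz p hp.out.ne_one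
    refine ⟨e, fun T => ?_⟩
    have h0 : (p : ℂ) ^ e * (s : ℂ) ≠ 0 := by
      rw [← Nat.cast_pow, ← Nat.cast_mul, ← hd]; exact_mod_cast a.den_nz
    have hs' : ((s : ℤ) : ℂ)⁻¹ ∈ 𝒪 :=
      inv_intCast_mem_pIntegralSubring (fun h => hs (Int.natCast_dvd_natCast.mp h))
    have : (p : ℂ) ^ e * (((Polynomial.monomial n a).eval (T : ℚ) : ℚ) : ℂ)
        = a.num * ((s : ℤ) : ℂ)⁻¹ * (T : ℂ) ^ n := by
      rw [Polynomial.eval_monomial]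
      push_cast
      rw [Rat.cast_def a, hd]
      push_cast
      have h1 := left_ne_zero_of_mul h0
      have h2 := right_ne_zero_of_mul h0
      field_simp
    rw [this]
    exact mul_mem (mul_mem (intCast_mem 𝒪 _) hs') (pow_mem (natCast_mem 𝒪 T) n)

end PIntegralSubring

/-! ### Power sums twisted by a character. -/

/-- Faulhaber's formula for arithmetic progressions, to second order in the number of terms. -/
lemma exists_sum_range_add_pow_eq (k : ℕ) (x : ℚ) :
    ∃ R : Polynomial ℚ, ∀ T : ℕ, ∑ i ∈ Finset.range T, (x + i) ^ (k + 1)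
      = T * (Polynomial.bernoulli (k + 1)).eval x + T ^ 2 * R.eval (T : ℚ) := by
  set B := Polynomial.bernoulli (k + 2)
  set Q := B.comp (Polynomial.X + Polynomial.C x) with hQ
  have hsum (T : ℕ) : (k + 2 : ℚ) * ∑ i ∈ Finset.range T, (x + i) ^ (k + 1)
      = Q.eval (T : ℚ) - Q.eval 0 := by
    induction T with
    | zero => simp
    | succ T ih =>
      have := Polynomial.bernoulli_eval_one_add (k + 2) (x + T)
      rw [Finset.sum_range_succ, mul_add, ih, hQ]
      simp only [Polynomial.eval_comp, Polynomial.eval_add, Polynomial.eval_X, Polynomial.eval_C]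
      rw [show ((T + 1 : ℕ) : ℚ) + x = 1 + (x + T) by push_cast; ring, this,
        show (T : ℚ) + x = x + T by ring]
      push_cast
      simp only [B]
      ring
  -- The linear coefficient is read off from Q' = (k+2) · B_(k+1)(X + x).
  have hder : Q.coeff 1 = (k + 2 : ℚ) * (Polynomial.bernoulli (k + 1)).eval x := by
    have h1 : Q.derivative.coeff 0 = Q.coeff 1 := by simp [Polynomial.coeff_derivative]
    rw [← h1, hQ, Polynomial.derivative_comp, Polynomial.derivative_bernoulli,
      Polynomial.coeff_zero_eq_eval_zero]
    simp
  refine ⟨Polynomial.C (k + 2 : ℚ)⁻¹ * Q.divX.divX, fun T => ?_⟩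
  have e1 := congrArg (Polynomial.eval (T : ℚ)) (Polynomial.divX_mul_X_add Q)
  have e2 := congrArg (Polynomial.eval (T : ℚ)) (Polynomial.divX_mul_X_add Q.divX)
  simp only [Polynomial.eval_add, Polynomial.eval_mul, Polynomial.eval_X, Polynomial.eval_C,
    Polynomial.coeff_divX, zero_add, hder, Polynomial.coeff_zero_eq_eval_zero Q] at e1 e2
  have hk : (k + 2 : ℚ) ≠ 0 := by positivity
  apply mul_left_cancel₀ hk
  rw [hsum, Polynomial.eval_mul, Polynomial.eval_C, ← e1, ← e2]
  field_simp
  ring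

lemma Finset.sum_range_mul_eq_sum_zmod {M : Type*} [AddCommMonoid M] (N T : ℕ) [NeZero N]
    (h : ℕ → M) : ∑ a ∈ Finset.range (N * T), h a
      = ∑ j : ZMod N, ∑ i ∈ Finset.range T, h (j.val + N * i) := by
  obtain ⟨N, rfl⟩ := Nat.exists_eq_succ_of_ne_zero (NeZero.ne N)
  have hz (g : ℕ → M) : ∑ j : ZMod (N + 1), g j.val = ∑ a ∈ Finset.range (N + 1), g a :=
    Fin.sum_univ_eq_sum_range g (N + 1)
  induction T with
  | zero => simp
  | succ T ih =>
    simp_rw [Finset.sum_range_succ]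
    rw [Finset.sum_add_distrib, ← ih, Nat.mul_succ, Finset.sum_range_add]
    congr 1
    rw [hz (fun a => h (a + N.succ * T))]
    exact Finset.sum_congr rfl fun a _ => by rw [add_comm]

lemma Finset.sum_zmod_val {M : Type*} [AddCommMonoid M] (N : ℕ) [NeZero N] (g : ℕ → M) :
    ∑ j : ZMod N, g j.val = ∑ a ∈ Finset.range N, g a := by
  have := Finset.sum_range_mul_eq_sum_zmod N 1 g
  simpa using this.symm

lemma DirichletCharacter.isIntegral_apply {N : ℕ} [NeZero N] (χ : DirichletCharacter ℂ N)
    (a : ZMod N) : IsIntegral ℤ (χ a) := by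
  by_cases h : IsUnit a
  · have h1 : a ^ Fintype.card (ZMod N)ˣ = 1 := by
      obtain ⟨u, rfl⟩ := h
      rw [← Units.val_pow_eq_pow_val, pow_card_eq_one, Units.val_one]
    refine IsIntegral.of_pow (n := Fintype.card (ZMod N)ˣ) Fintype.card_pos ?_
    rw [← map_pow, h1, map_one]; exact isIntegral_one
  · rw [χ.map_nonunit h]; exact isIntegral_zero

section PIntegralSubring

variable {p : ℕ} [hp : Fact p.Prime]

local notation "𝒪" => pIntegralSubring p

/-- Sums of powers twisted by a character are approximated by `L`-values. -/
lemma exists_sum_range_char_mul_pow_eq {N : ℕ} [NeZero N] (χ : DirichletCharacter ℂ N)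
    (hχ : χ ≠ 1) (k : ℕ) : ∃ e : ℕ, ∀ T : ℕ, ∃ r : ℂ, (p : ℂ) ^ e * r ∈ 𝒪 ∧
      ∑ a ∈ Finset.range (N * T), χ (a : ZMod N) * (a : ℂ) ^ (k + 1)
        = -((k + 1) * (N * T) * LNeg χ k) + T ^ 2 * r := by
  have hN0 : (N : ℂ) ≠ 0 := by exact_mod_cast NeZero.ne N
  have hk0 : (k + 1 : ℂ) ≠ 0 := by exact_mod_cast k.succ_ne_zero
  choose R hR using fun j : ZMod N => exists_sum_range_add_pow_eq k ((j.val : ℚ) / N)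
  choose e he using fun j : ZMod N => exists_pow_mul_eval_mem_pIntegralSubring (p := p) (R j)
  refine ⟨∑ j, e j, fun T => ⟨∑ j : ZMod N, χ j * (N : ℂ) ^ (k + 1) *
    (((R j).eval (T : ℚ) : ℚ) : ℂ), ?_, ?_⟩⟩
  · rw [Finset.mul_sum]
    refine sum_mem fun j _ => ?_
    have h1 : ∑ i, e i = e j + ∑ i ∈ Finset.univ.erase j, e i :=
      (Finset.add_sum_erase _ _ (Finset.mem_univ j)).symm
    rw [h1, pow_add]
    have := mul_mem (mul_mem (pow_mem (natCast_mem 𝒪 p) (∑ i ∈ Finset.univ.erase j, e i))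
      (mul_mem (χ.isIntegral_apply j).mem_pIntegralSubring (pow_mem (natCast_mem 𝒪 N) (k + 1))))
      (he j T)
    convert this using 1
    ring
  · have hj (j : ZMod N) : ∑ i ∈ Finset.range T, χ ((j.val + N * i : ℕ) : ZMod N)
        * ((j.val + N * i : ℕ) : ℂ) ^ (k + 1)
        = χ j * (N : ℂ) ^ (k + 1) *
          (T * (((Polynomial.bernoulli (k + 1)).eval ((j.val : ℚ) / N) : ℚ) : ℂ)
            + T ^ 2 * (((R j).eval (T : ℚ) : ℚ) : ℂ)) := by
      have := congrArg (fun q : ℚ => (q : ℂ)) (hR j T)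
      push_cast at this
      rw [← this, Finset.mul_sum]
      refine Finset.sum_congr rfl fun i _ => ?_
      have : ((j.val + N * i : ℕ) : ZMod N) = j := by simp
      rw [this, mul_assoc, ← mul_pow]
      push_cast
      congr 2
      field_simp
    rw [Finset.sum_range_mul_eq_sum_zmod, LNeg_eq_sum_bernoulli χ hχ k]
    simp_rw [hj]
    rw [Finset.mul_sum, Finset.mul_sum, Finset.mul_sum, ← Finset.sum_neg_distrib,
      ← Finset.sum_add_distrib]
    refine Finset.sum_congr rfl fun j _ => ?_
    field_simp
    ring

/-! ### Voronoi's and Kummer's congruences for regularized values. -/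

/-- The sum appearing in Voronoi's congruence. -/
noncomputable def voronoiSum {N : ℕ} (χ : DirichletCharacter ℂ N) (c : ℤ) (F : ℕ) [NeZero F]
    (k : ℕ) : ℂ :=
  ∑ x : ZMod F, χ ((c * x.val : ℤ) : ZMod N) * ((c * x.val : ℤ) : ℂ) ^ k
    * ((c * x.val / F : ℤ) : ℂ)

lemma voronoiSum_mem {N : ℕ} [NeZero N] (χ : DirichletCharacter ℂ N) (c : ℤ) (F : ℕ) [NeZero F]
    (k : ℕ) : voronoiSum χ c F k ∈ 𝒪 :=
  sum_mem fun _ _ => mul_mem (mul_mem (χ.isIntegral_apply _).mem_pIntegralSubring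
    (pow_mem (intCast_mem _ _) _)) (intCast_mem _ _)

lemma ZMod.sum_mul_left_val {F : ℕ} [NeZero F] {M : Type*} [AddCommMonoid M] {c : ℤ}
    (hc : IsCoprime c F) (g : ℤ → M) :
    ∑ x : ZMod F, g (c * x.val % F) = ∑ x : ZMod F, g x.val := by
  have hu : IsUnit (c : ZMod F) := by
    obtain ⟨u, v, h⟩ := hc
    refine IsUnit.of_mul_eq_one (u : ZMod F) ?_
    have := congrArg (fun z : ℤ => (z : ZMod F)) h
    push_cast at this
    rw [mul_comm]; simpa using this
  obtain ⟨u, hu⟩ := hu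
  rw [← Equiv.sum_comp (Units.mulLeft u) (fun x : ZMod F => g x.val)]
  refine Finset.sum_congr rfl fun x _ => ?_
  rw [← ZMod.val_intCast, Units.mulLeft_apply, hu]
  push_cast [ZMod.natCast_zmod_val]
  rfl

/-- Voronoi's congruence. -/
lemma exists_one_sub_mul_sum_eq_voronoiSum {N : ℕ} [NeZero N] (χ : DirichletCharacter ℂ N)
    {c : ℤ} {F : ℕ} [NeZero F] (hF : N ∣ F) (hc : IsCoprime c F) (k : ℕ) :
    ∃ w ∈ 𝒪, (1 - χ c * (c : ℂ) ^ (k + 1)) *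
        ∑ a ∈ Finset.range F, χ (a : ZMod N) * (a : ℂ) ^ (k + 1)
      = -((k + 1) * F * voronoiSum χ c F k) + F ^ 2 * w := by
  set S := ∑ a ∈ Finset.range F, χ (a : ZMod N) * (a : ℂ) ^ (k + 1) with hS
  -- Binomial expansion of cx mod F = cx - F⌊cx/F⌋, kept to first order in F.
  have hw (x : ZMod F) : ∃ w : ℤ, (c * x.val % F : ℤ) ^ (k + 1) = (c * x.val) ^ (k + 1)
      - (k + 1) * F * (c * x.val) ^ k * (c * x.val / F) + F ^ 2 * w := by
    obtain ⟨w, hw⟩ := Polynomial.powAddExpansion (c * x.val : ℤ) (-(F * (c * x.val / F))) (k + 1)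
    refine ⟨w * (c * x.val / F) ^ 2, ?_⟩
    rw [Int.emod_def, sub_eq_add_neg, hw]
    push_cast
    ring
  choose w hw using hw
  have h1 : S = ∑ x : ZMod F, χ ((c * x.val : ℤ) : ZMod N) * ((c * x.val % F : ℤ) : ℂ) ^ (k + 1) := by
    rw [hS, ← Finset.sum_zmod_val F (fun a => χ (a : ZMod N) * (a : ℂ) ^ (k + 1))]
    have := ZMod.sum_mul_left_val hc (fun a : ℤ => χ (a : ZMod N) * (a : ℂ) ^ (k + 1))
    simp only [Int.cast_natCast] at this
    rw [← this]
    refine Finset.sum_congr rfl fun x _ => ?_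
    congr 2
    rw [ZMod.intCast_eq_intCast_iff]
    exact (Int.mod_modEq _ _).of_dvd (by exact_mod_cast hF)
  have h2 : χ c * (c : ℂ) ^ (k + 1) * S
      = ∑ x : ZMod F, χ ((c * x.val : ℤ) : ZMod N) * ((c * x.val : ℤ) : ℂ) ^ (k + 1) := by
    rw [hS, ← Finset.sum_zmod_val F (fun a => χ (a : ZMod N) * (a : ℂ) ^ (k + 1)), Finset.mul_sum]
    refine Finset.sum_congr rfl fun x _ => ?_
    push_cast
    rw [map_mul]
    ring
  refine ⟨∑ x : ZMod F, χ ((c * x.val : ℤ) : ZMod N) * (w x : ℂ), sum_mem fun x _ =>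
    mul_mem (χ.isIntegral_apply _).mem_pIntegralSubring (intCast_mem _ _), ?_⟩
  rw [sub_mul, one_mul, h2]
  nth_rw 1 [h1]
  rw [voronoiSum, Finset.mul_sum, Finset.mul_sum, ← Finset.sum_sub_distrib,
    ← Finset.sum_neg_distrib, ← Finset.sum_add_distrib]
  refine Finset.sum_congr rfl fun x _ => ?_
  have := congrArg (fun z : ℤ => (z : ℂ)) (hw x)
  simp only [Int.cast_pow, Int.cast_add, Int.cast_sub, Int.cast_mul, Int.cast_natCast,
    Int.cast_one] at this ⊢
  rw [this]
  ring

/-- The regularized `L`-value is the `p`-adic limit of the Voronoi sums. -/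
lemma exists_regularized_sub_voronoiSum {m : ℕ} (χ : DirichletCharacter ℂ (p ^ m)) (hχ : χ ≠ 1)
    {c : ℤ} (hc : ¬ (p : ℤ) ∣ c) (k n : ℕ) :
    ∃ M₀ : ℕ, ∀ M ≥ M₀, ∃ y ∈ 𝒪, (1 - χ c * (c : ℂ) ^ (k + 1)) * LNeg χ k
      - voronoiSum χ c (p ^ M) k = p ^ n * y := by
  have hp0 : (p : ℂ) ≠ 0 := by exact_mod_cast hp.out.ne_zero
  have hk0 : (k + 1 : ℂ) ≠ 0 := by exact_mod_cast k.succ_ne_zero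
  obtain ⟨e, he⟩ := exists_sum_range_char_mul_pow_eq (p := p) χ hχ k
  obtain ⟨v, s, hs, hd⟩ := Nat.exists_eq_pow_mul_and_not_dvd k.succ_ne_zero p hp.out.ne_one
  have hs' : ((s : ℤ) : ℂ)⁻¹ ∈ 𝒪 :=
    inv_intCast_mem_pIntegralSubring (fun h => hs (Int.natCast_dvd_natCast.mp h))
  -- The relation to be divided is (k+1)F(E - V) = X T² r - F² w with F = p^m T. In the exponent of
  -- T, `m` pays for F/T, `e` for the denominator of `r`, `v` for the `p`-part of k + 1, and `n` is
  -- the precision wanted.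
  refine ⟨m + (m + e + v + n), fun M hM => ?_⟩
  obtain ⟨j, rfl⟩ := Nat.exists_eq_add_of_le hM
  obtain ⟨r, hr, hS⟩ := he (p ^ (m + e + v + n + j))
  have hcop : IsCoprime c ((p ^ (m + (m + e + v + n) + j) : ℕ) : ℤ) := by
    push_cast
    refine IsCoprime.pow_right ?_
    exact ((Nat.prime_iff_prime_int.mp hp.out).coprime_iff_not_dvd.mpr hc).symm
  obtain ⟨w, hw, hV⟩ := exists_one_sub_mul_sum_eq_voronoiSum (p := p) χ
    (F := p ^ (m + (m + e + v + n) + j)) (pow_dvd_pow p (by omega)) hcop k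
  have hFT : p ^ m * p ^ (m + e + v + n + j) = p ^ (m + (m + e + v + n) + j) := by
    rw [← pow_add]; congr 1; ring
  generalize voronoiSum χ c (p ^ (m + (m + e + v + n) + j)) k = V at hV ⊢
  rw [← hFT] at hV
  rw [hS] at hV
  set X := 1 - χ c * (c : ℂ) ^ (k + 1)
  have hXm : X ∈ 𝒪 := sub_mem (one_mem _) (mul_mem (χ.isIntegral_apply _).mem_pIntegralSubring
    (pow_mem (intCast_mem _ _) _))
  have hkd : (k + 1 : ℂ) = p ^ v * s := by exact_mod_cast hd
  have hs0 : (s : ℂ) ≠ 0 := by rintro h; rw [hkd, h, mul_zero] at hk0; exact hk0 rfl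
  refine ⟨(X * p ^ j * (p ^ e * r) - p ^ (m + m + e + j) * w) * ((s : ℤ) : ℂ)⁻¹,
    mul_mem (sub_mem (mul_mem (mul_mem hXm (pow_mem (natCast_mem _ _) _)) hr)
      (mul_mem (pow_mem (natCast_mem _ _) _) hw)) hs', ?_⟩
  have hm0 : ((p:ℂ) ^ m * p ^ (m + e + v + n + j) * (k + 1)) ≠ 0 := by positivity
  apply mul_left_cancel₀ hm0
  push_cast at hV ⊢
  rw [hkd] at hV ⊢
  have e1 : (p:ℂ) ^ m * p ^ (m + e + v + n + j) * (p ^ v * s) * (p ^ n * ((X * p ^ j * (p ^ e * r)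
      - p ^ (m + m + e + j) * w) * (s : ℂ)⁻¹))
      = X * ((p ^ (m + e + v + n + j)) ^ 2 * r) - (p ^ m * p ^ (m + e + v + n + j)) ^ 2 * w := by
    field_simp
    ring
  rw [e1]
  linear_combination -hV

lemma regularized_mem {m : ℕ} (χ : DirichletCharacter ℂ (p ^ m)) (hχ : χ ≠ 1)
    {c : ℤ} (hc : ¬ (p : ℤ) ∣ c) (k : ℕ) : (1 - χ c * (c : ℂ) ^ (k + 1)) * LNeg χ k ∈ 𝒪 := by
  obtain ⟨M, hM⟩ := exists_regularized_sub_voronoiSum χ hχ hc k 0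
  obtain ⟨y, hy, h⟩ := hM M le_rfl
  rw [sub_eq_iff_eq_add.mp h]
  exact add_mem (mul_mem (pow_mem (natCast_mem _ _) _) hy) (voronoiSum_mem χ c _ k)

/-- Kummer's congruence for regularized `L`-values. -/
lemma exists_regularized_sub_regularized {m : ℕ} (hm : m ≠ 0) (χ : DirichletCharacter ℂ (p ^ m))
    (hχ : χ ≠ 1) {c : ℤ} (hc : ¬ (p : ℤ) ∣ c) {k l n : ℕ}
    (hkl : ∀ a : ℤ, ¬ (p : ℤ) ∣ a → (p : ℤ) ^ n ∣ a ^ l - a ^ k) :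
    ∃ y ∈ 𝒪, (1 - χ c * (c : ℂ) ^ (l + 1)) * LNeg χ l
      - (1 - χ c * (c : ℂ) ^ (k + 1)) * LNeg χ k = p ^ n * y := by
  obtain ⟨M₁, hM₁⟩ := exists_regularized_sub_voronoiSum χ hχ hc k n
  obtain ⟨M₂, hM₂⟩ := exists_regularized_sub_voronoiSum χ hχ hc l n
  obtain ⟨y₁, hy₁, h₁⟩ := hM₁ (max M₁ M₂) (le_max_left _ _)
  obtain ⟨y₂, hy₂, h₂⟩ := hM₂ (max M₁ M₂) (le_max_right _ _)
  -- Multiples of `p` contribute nothing since χ vanishes there (`m ≠ 0`), so `hkl` is needed only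
  -- at integers prime to `p`.
  have hterm (a : ℤ) : ∃ y ∈ 𝒪, χ (a : ZMod (p ^ m)) * (a : ℂ) ^ l
      - χ (a : ZMod (p ^ m)) * (a : ℂ) ^ k = p ^ n * y := by
    by_cases ha : (p : ℤ) ∣ a
    · refine ⟨0, zero_mem _, ?_⟩
      rw [χ.map_nonunit]
      · simp
      · intro h
        have h2 := h.map (ZMod.castHom (dvd_pow_self p hm) (ZMod p))
        rw [map_intCast, (ZMod.intCast_zmod_eq_zero_iff_dvd a p).mpr ha] at h2
        exact not_isUnit_zero h2
    · obtain ⟨t, ht⟩ := hkl a ha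
      refine ⟨χ (a : ZMod (p ^ m)) * t, mul_mem (χ.isIntegral_apply _).mem_pIntegralSubring
        (intCast_mem _ _), ?_⟩
      have := congrArg (fun z : ℤ => (z : ℂ)) ht
      push_cast at this
      linear_combination χ (a : ZMod (p ^ m)) * this
  choose g hg hg' using hterm
  refine ⟨y₂ - y₁ + ∑ x : ZMod (p ^ max M₁ M₂), g (c * x.val)
      * ((c * x.val / (p ^ max M₁ M₂ : ℕ) : ℤ) : ℂ),
    add_mem (sub_mem hy₂ hy₁) (sum_mem fun x _ => mul_mem (hg _) (intCast_mem _ _)), ?_⟩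
  have hV : voronoiSum χ c (p ^ max M₁ M₂) l - voronoiSum χ c (p ^ max M₁ M₂) k
      = p ^ n * ∑ x : ZMod (p ^ max M₁ M₂), g (c * x.val)
      * ((c * x.val / (p ^ max M₁ M₂ : ℕ) : ℤ) : ℂ) := by
    rw [voronoiSum, voronoiSum, ← Finset.sum_sub_distrib, Finset.mul_sum]
    refine Finset.sum_congr rfl fun x _ => ?_
    rw [← sub_mul, hg', mul_assoc]
  linear_combination h₂ - h₁ + hV

end PIntegralSubring

/-! ### Euler's congruence and the root of unity ζ = χ(1 + p). -/

lemma prime_pow_dvd_pow_sub_pow {p : ℕ} [hp : Fact p.Prime] {a : ℤ} (ha : ¬ (p : ℤ) ∣ a)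
    (k n q : ℕ) : (p : ℤ) ^ n ∣ a ^ (k + Nat.totient (p ^ n) * q) - a ^ k := by
  have hcop : IsCoprime a ((p ^ n : ℕ) : ℤ) := by
    push_cast
    exact ((Nat.prime_iff_prime_int.mp hp.out).coprime_iff_not_dvd.mpr ha).symm.pow_right
  obtain ⟨u, hu⟩ := (ZMod.coe_int_isUnit_iff_isCoprime a (p ^ n)).mpr hcop.symm
  have h1 : (a : ZMod (p ^ n)) ^ Nat.totient (p ^ n) = 1 := by
    rw [← hu, ← Units.val_pow_eq_pow_val, ZMod.pow_totient, Units.val_one]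
  have h2 : ((a ^ (k + Nat.totient (p ^ n) * q) - a ^ k : ℤ) : ZMod (p ^ n)) = 0 := by
    push_cast
    rw [pow_add, pow_mul, h1, one_pow, mul_one, sub_self]
  have := (ZMod.intCast_zmod_eq_zero_iff_dvd _ _).mp h2
  exact_mod_cast this

/-- The element Y = (1 + p)^(p^r) generates the kernel of reduction from level p^(r+2) to level
p^(r+1); were χ(Y) = 1, the character would factor through p^(r+1), against primitivity. -/
lemma DirichletCharacter.IsPrimitive.apply_one_add_pow_ne_one {p r : ℕ} [hp : Fact p.Prime]
    (hp2 : p ≠ 2) {χ : DirichletCharacter ℂ (p ^ (r + 2))} (hχ : χ.IsPrimitive) :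
    χ (1 + p) ^ p ^ r ≠ 1 := by
  intro h
  have hd : p ^ (r + 1) ∣ p ^ (r + 2) := pow_dvd_pow p (by omega)
  set Y : ℤ := (1 + p) ^ p ^ r with hY
  obtain ⟨v, hv⟩ : (p : ℤ) ^ (r + 1) ∣ Y - 1 := by
    have h1 := pow_orderOf_eq_one (1 + p : ZMod (p ^ (r + 1)))
    rw [ZMod.orderOf_one_add_prime hp.out hp2 r] at h1
    have h2 : ((Y - 1 : ℤ) : ZMod (p ^ (r + 1))) = 0 := by rw [hY]; push_cast; rw [h1, sub_self]
    exact_mod_cast (ZMod.intCast_zmod_eq_zero_iff_dvd _ _).mp h2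
  -- Otherwise Y ≡ 1 mod p^(r+2), contradicting the order p^(r+1) of 1 + p at that level.
  have hpv : ¬ (p : ℤ) ∣ v := by
    rintro ⟨w, rfl⟩
    have h2 : ((Y - 1 : ℤ) : ZMod (p ^ (r + 1 + 1))) = 0 := by
      rw [ZMod.intCast_zmod_eq_zero_iff_dvd]
      exact ⟨w, by rw [hv]; push_cast; ring⟩
    rw [hY] at h2
    push_cast at h2
    have h3 := orderOf_dvd_of_pow_eq_one (sub_eq_zero.mp h2)
    rw [ZMod.orderOf_one_add_prime hp.out hp2 (r + 1), Nat.pow_dvd_pow_iff_le_right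
      hp.out.one_lt] at h3
    omega
  have hfac : χ.FactorsThrough (p ^ (r + 1)) := by
    rw [DirichletCharacter.factorsThrough_iff_ker_unitsMap hd]
    intro u hu
    rw [MonoidHom.mem_ker] at hu ⊢
    have hu1 : (u : ZMod (p ^ (r + 2))).cast = (1 : ZMod (p ^ (r + 1))) := by
      have := congrArg Units.val hu
      simpa [ZMod.unitsMap_val] using this
    obtain ⟨U, hU⟩ := ZMod.intCast_surjective (u : ZMod (p ^ (r + 2)))
    obtain ⟨b, hb⟩ : (p : ℤ) ^ (r + 1) ∣ U - 1 := by
      rw [← hU, ZMod.cast_intCast hd] at hu1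
      have h2 : ((U - 1 : ℤ) : ZMod (p ^ (r + 1))) = 0 := by
        push_cast; rw [hu1, sub_self]
      exact_mod_cast (ZMod.intCast_zmod_eq_zero_iff_dvd _ _).mp h2
    have hv0 : (v : ZMod p) ≠ 0 := by rwa [ne_eq, ZMod.intCast_zmod_eq_zero_iff_dvd]
    -- With U = 1 + p^(r+1) b and Y = 1 + p^(r+1) v, the power Y^j agrees with U mod p^(r+2) exactly
    -- when jv ≡ b mod `p`.
    set j : ℕ := ((b : ZMod p) / v).val with hj
    obtain ⟨w, hw⟩ : (p : ℤ) ∣ j * v - b := by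
      rw [← ZMod.intCast_zmod_eq_zero_iff_dvd]
      push_cast
      rw [hj, ZMod.natCast_zmod_val, div_mul_cancel₀ _ hv0, sub_self]
    obtain ⟨z, hz⟩ := Polynomial.powAddExpansion (1 : ℤ) ((p : ℤ) ^ (r + 1) * v) j
    have hUY : (U : ZMod (p ^ (r + 2))) = (Y : ZMod (p ^ (r + 2))) ^ j := by
      rw [← Int.cast_pow, ZMod.intCast_eq_intCast_iff_dvd_sub]
      refine ⟨w + z * v ^ 2 * p ^ r, ?_⟩
      rw [show Y = 1 + p ^ (r + 1) * v by rw [← hv]; ring, hz,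
        show U = 1 + p ^ (r + 1) * b by rw [← hb]; ring]
      simp only [one_pow, mul_one]
      push_cast
      linear_combination (p : ℤ) ^ (r + 1) * hw
    ext
    rw [MulChar.coe_toUnitHom, ← hU, hUY, map_pow, hY]
    push_cast
    rw [map_pow, h, one_pow]
  have h1 : χ.conductor ≤ p ^ (r + 1) := Nat.sInf_le hfac
  rw [hχ] at h1
  exact absurd ((Nat.pow_le_pow_iff_right hp.out.one_lt).mp h1) (by omega)

section PIntegralSubring

variable {p : ℕ} [hp : Fact p.Prime]

local notation "𝒪" => pIntegralSubring p

/-- For the primitive `p`-th root of unity η = ζ^(p^r), the square (η - 1)² divides `p` because 2 <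
p, and 1 - ζ divides 1 - η. -/
lemma exists_prime_eq_sq_mul {r : ℕ} (hp2 : p ≠ 2) {ζ : ℂ} (h1 : ζ ^ p ^ (r + 1) = 1)
    (h2 : ζ ^ p ^ r ≠ 1) : ∃ ρ ∈ 𝒪, (p : ℂ) = (1 - ζ) ^ 2 * ρ := by
  have hη : IsPrimitiveRoot (ζ ^ p ^ r) p := by
    rw [IsPrimitiveRoot.iff_orderOf]
    exact orderOf_eq_prime (by rw [← pow_mul, ← pow_succ, h1]) h2
  have hζ : IsIntegral ℤ ζ := IsIntegral.of_pow (pow_pos hp.out.pos (r + 1)) (by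
    rw [h1]; exact isIntegral_one)
  have h3 : 2 < p := lt_of_le_of_ne hp.out.two_le hp2.symm
  obtain ⟨z, hz, hpz⟩ := hη.self_sub_one_pow_dvd_order h3
  have hzI : IsIntegral ℤ z := (adjoin_le_integralClosure
    (hζ.pow (p ^ r))) hz
  refine ⟨z * (∑ i ∈ Finset.range (p ^ r), ζ ^ i) ^ 2, mul_mem hzI.mem_pIntegralSubring
    (pow_mem (sum_mem fun i _ => (hζ.pow i).mem_pIntegralSubring) 2), ?_⟩
  rw [hpz, ← mul_geom_sum]
  ring

/-- Modulo `p`, (1 - ζ)^(p^r) ≡ 1 - ζ^(p^r) = 0. This places 1 - ζ in the Jacobson radical. -/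
lemma exists_one_sub_pow_eq_prime_mul {r : ℕ} (hp2 : p ≠ 2) {ζ : ℂ} (h1 : ζ ^ p ^ r = 1)
    (hζ : ζ ∈ 𝒪) : ∃ y ∈ 𝒪, (1 - ζ) ^ p ^ r = p * y := by
  obtain ⟨y, hy⟩ := exists_add_pow_prime_pow_eq hp.out (1 : 𝒪) (-⟨ζ, hζ⟩) r
  have := congrArg (fun z : 𝒪 => (z : ℂ)) hy
  push_cast at this
  have hodd : Odd (p ^ r) := (hp.out.odd_of_ne_two hp2).pow
  rw [hodd.neg_pow, h1, one_pow, ← sub_eq_add_neg] at this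
  refine ⟨-ζ * y, mul_mem (neg_mem hζ) y.2, ?_⟩
  rw [this]; ring

/-! ### Reduction to a residue field. -/

/-- A single maximal ideal serves all a: the units mod p^m are cyclic, so it is enough that
χ(b)b^(k+1) = 1 in the residue field for a generator b. At multiples of `p` both sides vanish, by
the convention 0⁻¹ = 0. -/
lemma exists_field_hom_of_not_primeTo {m : ℕ} (hm : m ≠ 0) (hp2 : p ≠ 2)
    (χ : DirichletCharacter ℂ (p ^ m)) (k : ℕ)
    (hno : ∀ a : ℤ, ¬ (p : ℤ) ∣ a →
      ¬ PrimeTo p (1 - χ (a : ZMod (p ^ m)) * (a : ℂ) ^ (k + 1))) :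
    ∃ (K : Type) (_ : Field K) (_ : CharP K p) (φ : integralClosure ℤ ℂ →+* K), ∀ a : ℤ,
      φ ⟨χ a, χ.isIntegral_apply _⟩ * (a : K) ^ k = (a : K)⁻¹ := by
  let A := integralClosure ℤ ℂ
  have hcyc := ZMod.isCyclic_units_of_prime_pow p hp.out hp2 m
  obtain ⟨g, hg⟩ := hcyc.exists_generator
  obtain ⟨b, hb⟩ := ZMod.intCast_surjective (g : ZMod (p ^ m))
  have hcast {a c : ℤ} (h : (a : ZMod (p ^ m)) = c) : (a : ZMod p) = c := by
    have := congrArg (ZMod.castHom (dvd_pow_self p hm) (ZMod p)) h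
    simpa using this
  have hunit {a : ℤ} (h : IsUnit (a : ZMod (p ^ m))) : ¬ (p : ℤ) ∣ a := by
    intro h0
    have h2 := h.map (ZMod.castHom (dvd_pow_self p hm) (ZMod p))
    rw [map_intCast, (ZMod.intCast_zmod_eq_zero_iff_dvd a p).mpr h0] at h2
    exact not_isUnit_zero h2
  have hpb : ¬ (p : ℤ) ∣ b := hunit (by rw [hb]; exact g.isUnit)
  let X : ZMod (p ^ m) → A := fun a => ⟨χ a, χ.isIntegral_apply _⟩
  let x : A := 1 - X b * (b : A) ^ (k + 1)
  have hspan : Ideal.span {x, (p : A)} ≠ ⊤ := by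
    intro htop
    have h1 : (1 : A) ∈ Ideal.span {x, (p : A)} := by rw [htop]; trivial
    obtain ⟨u, v, huv⟩ := Ideal.mem_span_pair.mp h1
    refine hno b hpb ⟨?_, u, v, u.2, v.2, ?_⟩
    · exact isIntegral_one.sub ((χ.isIntegral_apply _).mul
        (IsIntegral.pow (isIntegral_algebraMap (x := b)) _))
    · have := congrArg (fun z : A => (z : ℂ)) huv
      simpa [x, X] using this
  obtain ⟨I, hI, hle⟩ := Ideal.exists_le_maximal _ hspan
  let _ : Field (A ⧸ I) := Ideal.Quotient.field I
  have hx : Ideal.Quotient.mk I x = 0 :=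
    Ideal.Quotient.eq_zero_iff_mem.mpr (hle (Ideal.subset_span (by simp)))
  have hp0 : ((p : ℕ) : A ⧸ I) = 0 := by
    have : Ideal.Quotient.mk I (p : A) = 0 :=
      Ideal.Quotient.eq_zero_iff_mem.mpr (hle (Ideal.subset_span (by simp)))
    simpa using this
  have : CharP (A ⧸ I) p := by
    obtain ⟨q, hq⟩ := CharP.exists (A ⧸ I)
    rcases (Nat.dvd_prime hp.out).mp ((CharP.cast_eq_zero_iff _ q p).mp hp0) with h | h
    · exact absurd h (CharP.char_ne_one (A ⧸ I) q)
    · exact h ▸ hq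
  have hzmod {a c : ℤ} (h : (a : ZMod p) = c) : (a : A ⧸ I) = c := by
    have := congrArg (ZMod.castHom dvd_rfl (A ⧸ I)) h
    simpa using this
  refine ⟨A ⧸ I, inferInstance, inferInstance, Ideal.Quotient.mk I, fun a => ?_⟩
  by_cases ha : IsUnit (a : ZMod (p ^ m))
  · obtain ⟨u, hu⟩ := ha
    obtain ⟨i, hi⟩ := (mem_powers_iff_mem_zpowers.mpr (hg u))
    have hi : g ^ i = u := hi
    have h1 : (a : ZMod (p ^ m)) = (b ^ i : ℤ) := by
      rw [← hu, ← hi]; push_cast; rw [hb]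
    have h2 : (a : A ⧸ I) = b ^ i := by
      have := hzmod (hcast h1); push_cast at this; exact this
    have h3 : (X a) = X b ^ i := by
      ext
      simp only [X, SubmonoidClass.coe_pow]
      rw [h1]; push_cast; rw [map_pow]
    have h4 : Ideal.Quotient.mk I (X b) * (b : A ⧸ I) ^ (k + 1) = 1 := by
      have : Ideal.Quotient.mk I x = 1 - Ideal.Quotient.mk I (X b) * (b : A ⧸ I) ^ (k + 1) := by
        simp [x]
      rw [this] at hx
      exact (sub_eq_zero.mp hx).symm
    refine eq_inv_of_mul_eq_one_left ?_
    rw [mul_assoc, ← pow_succ]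
    change Ideal.Quotient.mk I (X a) * _ = 1
    rw [h3, h2, map_pow, ← pow_mul, mul_comm i, pow_mul, ← mul_pow, h4, one_pow]
  · have h0 : (⟨χ a, χ.isIntegral_apply _⟩ : A) = 0 := by
      ext; exact χ.map_nonunit ha
    have h1 : (a : A ⧸ I) = 0 := by
      have hdvd : (p : ℤ) ∣ a := by
        by_contra h
        refine ha ((ZMod.coe_int_isUnit_iff_isCoprime a (p ^ m)).mpr ?_)
        push_cast
        exact ((Nat.prime_iff_prime_int.mp hp.out).coprime_iff_not_dvd.mpr h).pow_left
      have := hzmod (a := a) (c := 0) (by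
        rw [(ZMod.intCast_zmod_eq_zero_iff_dvd a p).mpr hdvd]; simp)
      simpa using this
    rw [h0, h1, map_zero, zero_mul, inv_zero]

/-- The residue of the measure attached to `1 + p` against the function `x⁻¹`. -/
lemma sum_inv_mul_ediv_eq_neg_one (hp2 : p ≠ 2) (K : Type*) [Field K] [CharP K p] (M : ℕ) :
    ∑ x : ZMod (p ^ (M + 1)), ((x.val : ℤ) : K)⁻¹ *
      (((1 + p) * x.val / (p ^ (M + 1) : ℕ) : ℤ) : K) = -1 := by
  set F : ℕ := p ^ (M + 1) with hF
  set T : ℕ := p ^ M with hT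
  have hFT : F = p * T := by rw [hF, hT, pow_succ, mul_comm]
  -- An integer lift of a⁻¹ mod `p`: the sum must be divided by F before it is reduced mod `p`.
  let G : ℤ → ℤ := fun a => ((a : ZMod p)⁻¹).val
  have hG (a : ℤ) : (G a : K) = (a : K)⁻¹ := by
    have := congrArg (ZMod.castHom dvd_rfl K) (ZMod.natCast_zmod_val (a : ZMod p)⁻¹)
    rw [map_inv₀, map_intCast, map_natCast] at this
    simpa [G] using this
  have hGp {a b : ℤ} (h : (a : ZMod p) = b) : G a = G b := by simp only [G, h]
  have hc : IsCoprime (1 + p : ℤ) ((F : ℕ) : ℤ) := by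
    rw [hF]; push_cast
    exact IsCoprime.pow_right ⟨1, -1, by ring⟩
  have hperm := ZMod.sum_mul_left_val hc (fun a => G a * a)
  -- Write F⌊(1+p)x/F⌋ = (1+p)x - ((1+p)x mod F). As 1 + p ≡ 1 mod `p`, `G` is unchanged by x ↦
  -- (1+p)x mod F, and this permutation cancels everything but the term with factor `p`.
  have hsum : (F : ℤ) * ∑ x : ZMod F, G x.val * ((1 + p) * x.val / F)
      = p * ∑ x : ZMod F, G x.val * x.val := by
    have h1 (x : ZMod F) : (F : ℤ) * (G x.val * ((1 + p) * x.val / F))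
        = (1 + p) * (G x.val * x.val) -
          G ((1 + p) * x.val % F) * ((1 + p) * x.val % F) := by
      have : G ((1 + p) * x.val % F) = G x.val := by
        apply hGp
        rw [ZMod.intCast_eq_intCast_iff]
        refine ((Int.mod_modEq _ _).of_dvd (m := p) ⟨T, by rw [hFT]; push_cast; ring⟩).trans ?_
        exact (Int.modEq_iff_dvd.mpr ⟨-x.val, by ring⟩)
      rw [this, Int.emod_def]; ring
    rw [Finset.mul_sum, Finset.sum_congr rfl fun x _ => h1 x, Finset.sum_sub_distrib, hperm,
      ← Finset.mul_sum]
    ring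
  have hsum2 : 2 * ∑ x : ZMod F, G x.val * x.val
      = T * ∑ b : ZMod p, G b.val * (2 * b.val + p * (T - 1)) := by
    rw [Finset.sum_zmod_val F (fun a : ℕ => G a * (a : ℤ)), hFT,
      Finset.sum_range_mul_eq_sum_zmod, Finset.mul_sum, Finset.mul_sum]
    refine Finset.sum_congr rfl fun b _ => ?_
    have h2 (i : ℕ) : G ((b.val + p * i : ℕ) : ℤ) = G b.val := hGp (by simp)
    simp_rw [h2]
    have h3 : (∑ i ∈ Finset.range T, (i : ℤ)) * 2 = T * (T - 1) := by
      have := Finset.sum_range_id_mul_two T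
      zify at this
      rw [this, Nat.cast_sub (Nat.pos_of_ne_zero (pow_ne_zero _ hp.out.ne_zero)), Nat.cast_one]
    rw [← Finset.mul_sum]
    push_cast
    rw [Finset.sum_add_distrib, Finset.sum_const, Finset.card_range, ← Finset.mul_sum]
    simp only [nsmul_eq_mul]
    linear_combination G b.val * p * h3
  have hT0 : (T : ℤ) ≠ 0 := by exact_mod_cast pow_ne_zero _ hp.out.ne_zero
  have hp0 : (p : ℤ) ≠ 0 := by exact_mod_cast hp.out.ne_zero
  have hsum3 : 2 * ∑ x : ZMod F, G x.val * ((1 + p) * x.val / F)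
      = ∑ b : ZMod p, G b.val * (2 * b.val + p * (T - 1)) := by
    apply mul_left_cancel₀ (mul_ne_zero hp0 hT0)
    have : (F : ℤ) = p * T := by exact_mod_cast hFT
    rw [← this]
    rw [this] at hsum ⊢
    linear_combination 2 * hsum + p * hsum2
  have hK := congrArg (fun z : ℤ => (z : K)) hsum3
  simp only [Int.cast_mul, Int.cast_sum, hG, Int.cast_add, Int.cast_ofNat, Int.cast_natCast,
    CharP.cast_eq_zero, zero_mul, add_zero] at hK
  have h2 : (2 : K) ≠ 0 := by
    intro h
    have : ((2 : ℕ) : K) = 0 := by exact_mod_cast h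
    rw [CharP.cast_eq_zero_iff K p] at this
    exact hp2 ((Nat.prime_dvd_prime_iff_eq hp.out Nat.prime_two).mp this)
  -- The p - 1 nonzero residues contribute 2 each, and p - 1 = -1 in K.
  have hb : ∑ b : ZMod p, ((b.val : K)⁻¹ * (2 * b.val)) = 2 * (-1) := by
    have h3 (b : ZMod p) : (b.val : K)⁻¹ * (2 * b.val) = 2 * (1 - if b = 0 then 1 else 0) := by
      split_ifs with h
      · simp [h]
      · have : (b.val : K) ≠ 0 := by
          rw [ne_eq, CharP.cast_eq_zero_iff K p]
          intro h'
          exact h (by rw [← ZMod.natCast_zmod_val b]; exact (ZMod.natCast_eq_zero_iff _ _).mpr h')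
        field_simp
        ring
    rw [Finset.sum_congr rfl fun b _ => h3 b, ← Finset.mul_sum, Finset.sum_sub_distrib]
    simp
  rw [hb] at hK
  have := mul_left_cancel₀ h2 hK
  simpa only [Int.cast_natCast] using this

end PIntegralSubring

/-! ### Variation of the Euler factors with k. -/

/-- The expansion of `(1 + p) ^ (φ(p ^ (j + 1)) q)` to second order. -/
lemma exists_one_add_prime_pow_totient_mul {p : ℕ} [hp : Fact p.Prime] (hp2 : p ≠ 2) (j q : ℕ) :
    ∃ z : ℤ, (1 + p : ℤ) ^ (Nat.totient (p ^ (j + 1)) * q) = 1 + p ^ (j + 1) * (-q + p * z) := by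
  have h3 : 3 ≤ p := lt_of_le_of_ne hp.out.two_le hp2.symm
  obtain ⟨y, hy⟩ := ZMod.exists_one_add_mul_pow_prime_pow_eq (R := ℤ) (u := p) (v := p) hp.out
    dvd_rfl (by
      rw [← pow_two, ← pow_succ]; exact pow_dvd_pow _ h3) 1 j
  rw [mul_one] at hy
  obtain ⟨w, hw⟩ := Polynomial.powAddExpansion (1 : ℤ) ((p : ℤ) ^ j * p * (1 + p * y))
    ((p - 1) * q)
  -- Since (1 + p)^(p^j) = 1 + p^(j+1)(1 + py), the linear term has coefficient (p - 1)q ≡ -q mod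
  -- `p`.
  refine ⟨q + (p - 1) * q * y + w * (p : ℤ) ^ j * (1 + p * y) ^ 2, ?_⟩
  rw [Nat.totient_prime_pow_succ hp.out, mul_assoc, pow_mul, hy, hw]
  push_cast [Nat.cast_sub hp.out.one_le]
  simp only [one_pow]
  ring

lemma PrimeTo.of_sub_eq_prime_mul {p : ℕ} {x x' t : ℂ} (hx : PrimeTo p x) (ht : IsIntegral ℤ t)
    (h : x' - x = p * t) : PrimeTo p x' := by
  obtain ⟨hxI, u, v, hu, hv, huv⟩ := hx
  refine ⟨?_, u, v - u * t, hu, hv.sub (hu.mul ht), by linear_combination huv + u * h⟩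
  rw [sub_eq_iff_eq_add.mp h]
  exact ((isIntegral_algebraMap (x := (p : ℤ))).mul ht).add hxI

section PIntegralSubring

variable {p : ℕ} [hp : Fact p.Prime]

local notation "𝒪" => pIntegralSubring p

lemma congrModPow_iff {n : ℕ} {x y : ℂ} :
    CongrModPow p n x y ↔ ∃ z ∈ 𝒪, x - y = p ^ n * z := by
  have hp0 : (p : ℂ) ^ n ≠ 0 := pow_ne_zero _ (by exact_mod_cast hp.out.ne_zero)
  constructor
  · intro h
    exact ⟨_, h, by field_simp⟩
  · rintro ⟨z, hz, h⟩
    rw [CongrModPow, h, mul_div_cancel_left₀ _ hp0]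
    exact hz

lemma CongrModPow.symm {n : ℕ} {x y : ℂ} (h : CongrModPow p n x y) : CongrModPow p n y x := by
  rw [congrModPow_iff] at h ⊢
  obtain ⟨z, hz, h⟩ := h
  exact ⟨-z, neg_mem hz, by linear_combination -h⟩

/-- Kummer's congruence, when the Euler factor at some integer is prime to `p`. -/
lemma congrModPow_LNeg_of_primeTo {m : ℕ} (hm : m ≠ 0) (χ : DirichletCharacter ℂ (p ^ m))
    (hχ : χ ≠ 1) {a : ℤ} (ha : ¬ (p : ℤ) ∣ a) (k n q : ℕ) (hn : n ≠ 0)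
    (hprime : PrimeTo p (1 - χ a * (a : ℂ) ^ (k + 1))) :
    CongrModPow p n (LNeg χ (k + Nat.totient (p ^ n) * q)) (LNeg χ k) := by
  set l := k + Nat.totient (p ^ n) * q with hl
  obtain ⟨u, hu, hu1⟩ := hprime.exists_mul_eq_one
  obtain ⟨y, hy, hE⟩ := exists_regularized_sub_regularized hm χ hχ ha
    (fun b hb => prime_pow_dvd_pow_sub_pow hb k n q)
  have hEm := regularized_mem χ hχ ha k
  obtain ⟨t, ht⟩ := prime_pow_dvd_pow_sub_pow ha k n q
  rw [← hl] at ht hE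
  have htC := congrArg (fun z : ℤ => (z : ℂ)) ht
  push_cast at htC
  have hχa := (χ.isIntegral_apply (a : ZMod (p ^ m))).mem_pIntegralSubring (p := p)
  set s : ℂ := χ a * a * t with hs
  have hsm : s ∈ 𝒪 := mul_mem (mul_mem hχa (intCast_mem _ _)) (intCast_mem _ _)
  set x := 1 - χ a * (a : ℂ) ^ (k + 1) with hx
  set x' := 1 - χ a * (a : ℂ) ^ (l + 1) with hx'
  have hxx : x' = x - p ^ n * s := by
    rw [hx, hx', hs, pow_succ, pow_succ]; linear_combination -χ a * a * htC
  -- The factor x' differs from the unit x by a multiple of p^n; n ≥ 1 makes x' a unit as well.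
  obtain ⟨n, rfl⟩ := Nat.exists_eq_add_one_of_ne_zero hn
  obtain ⟨v, hv, hv1⟩ := exists_mul_eq_one_of_one_sub_prime_mul (p := p)
    (t := p ^ n * s * u) (mul_mem (mul_mem (pow_mem (natCast_mem _ _) _) hsm) hu)
  have hw1 : x' * (u * v) = 1 := by
    rw [hxx]
    linear_combination v * hu1 + hv1
  rw [congrModPow_iff]
  refine ⟨u * v * y + u * v * u * s * (x * LNeg χ k),
    add_mem (mul_mem (mul_mem hu hv) hy)
      (mul_mem (mul_mem (mul_mem (mul_mem hu hv) hu) hsm) hEm), ?_⟩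
  have e1 : LNeg χ l = u * v * (x' * LNeg χ l) := by linear_combination -LNeg χ l * hw1
  have e2 : LNeg χ k = u * (x * LNeg χ k) := by linear_combination -LNeg χ k * hu1
  have e3 : u * v - u = u * v * u * p ^ (n + 1) * s := by
    linear_combination -u * v * hu1 + u * hw1 - u * v * u * hxx
  linear_combination e1 - e2 + u * v * hE + (x * LNeg χ k) * e3

/-- For a `p`-power root of unity `ζ` with `(1 - ζ) ^ 2 ∣ p`, the Euler factor
`1 - ζ (1 + p) ^ (k + 1)` is `1 - ζ` times a unit congruent to `1` modulo `1 - ζ`. -/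
lemma exists_unit_factor {r : ℕ} (hp2 : p ≠ 2) {ζ : ℂ} (hζm : ζ ∈ 𝒪)
    (h1 : ζ ^ p ^ (r + 1) = 1) {ρ : ℂ} (hρ : ρ ∈ 𝒪) (hpρ : (p : ℂ) = (1 - ζ) ^ 2 * ρ) (k : ℕ) :
    ∃ a ∈ 𝒪, ∃ v ∈ 𝒪, 1 - ζ * ((1 + p : ℤ) : ℂ) ^ (k + 1) = (1 - ζ) * (1 + (1 - ζ) * a) ∧
      (1 + (1 - ζ) * a) * v = 1 := by
  obtain ⟨w, hw⟩ : (p : ℤ) ∣ (1 + p : ℤ) ^ (k + 1) - 1 := by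
    have := sub_dvd_pow_sub_pow (1 + p : ℤ) 1 (k + 1)
    rwa [one_pow, add_sub_cancel_left] at this
  have hwC := congrArg (fun z : ℤ => (z : ℂ)) hw
  push_cast at hwC
  have ham : ζ * ρ * w ∈ 𝒪 := mul_mem (mul_mem hζm hρ) (intCast_mem _ _)
  obtain ⟨y, hy, hy1⟩ := exists_one_sub_pow_eq_prime_mul hp2 h1 hζm
  obtain ⟨v, hv, hv1⟩ := exists_mul_eq_one_of_pow_eq_prime_mul
    (sub_mem (one_mem _) hζm) hy ham hy1
  -- With (1 + p)^(k+1) = 1 + pw, the factor is (1 - ζ) - ζpw, and p = (1 - ζ)²ρ.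
  refine ⟨-(ζ * ρ * w), neg_mem ham, v, hv, ?_, ?_⟩
  · push_cast
    linear_combination -ζ * hwC - ζ * w * hpρ
  · linear_combination hv1

/-! ### Regularized values at c = 1 + p and the size of their variation. -/

variable {r : ℕ} {χ : DirichletCharacter ℂ (p ^ (r + 2))}

lemma DirichletCharacter.apply_one_add_pow_eq_one (hp2 : p ≠ 2)
    (χ : DirichletCharacter ℂ (p ^ (r + 2))) : χ (1 + p) ^ p ^ (r + 1) = 1 := by
  have := pow_orderOf_eq_one (1 + p : ZMod (p ^ (r + 1 + 1)))
  rw [ZMod.orderOf_one_add_prime hp.out hp2 (r + 1)] at this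
  rw [← map_pow, this, map_one]

lemma DirichletCharacter.IsPrimitive.ne_one_of_prime_pow {m : ℕ} (hm : m ≠ 0)
    {χ : DirichletCharacter ℂ (p ^ m)} (hχ : χ.IsPrimitive) : χ ≠ 1 := by
  rintro rfl
  rw [DirichletCharacter.isPrimitive_def, DirichletCharacter.conductor_one] at hχ
  exact (Nat.one_lt_pow hm hp.out.one_lt).ne hχ

lemma not_dvd_one_add : ¬ (p : ℤ) ∣ 1 + p := by
  intro h
  have : (p : ℤ) ∣ 1 := by simpa using h
  exact hp.out.one_lt.ne' (by exact_mod_cast Int.eq_one_of_dvd_one (by positivity) this)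

/-- `(1 - χ(1 + p) (1 + p) ^ (k + 1)) L(-k, χ)`. -/
noncomputable def regularizedL (χ : DirichletCharacter ℂ (p ^ (r + 2))) (k : ℕ) : ℂ :=
  (1 - χ (1 + p) * ((1 + p : ℤ) : ℂ) ^ (k + 1)) * LNeg χ k

lemma regularizedL_mem (hχ : χ.IsPrimitive) (k : ℕ) : regularizedL χ k ∈ 𝒪 := by
  have := regularized_mem χ (hχ.ne_one_of_prime_pow (by omega)) (not_dvd_one_add (p := p)) k
  simpa [regularizedL] using this

lemma exists_regularizedL_sub (hχ : χ.IsPrimitive) {k l n : ℕ}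
    (hkl : ∀ a : ℤ, ¬ (p : ℤ) ∣ a → (p : ℤ) ^ n ∣ a ^ l - a ^ k) :
    ∃ y ∈ 𝒪, regularizedL χ l - regularizedL χ k = p ^ n * y := by
  have := exists_regularized_sub_regularized (by omega) χ (hχ.ne_one_of_prime_pow (by omega))
    (not_dvd_one_add (p := p)) hkl
  simpa [regularizedL] using this

lemma apply_one_add_mem : χ (1 + p) ∈ 𝒪 := (χ.isIntegral_apply _).mem_pIntegralSubring

lemma one_sub_apply_ne_zero (hp2 : p ≠ 2) (hχ : χ.IsPrimitive) : 1 - χ (1 + p) ≠ 0 := by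
  intro h
  refine hχ.apply_one_add_pow_ne_one hp2 ?_
  rw [← sub_eq_zero.mp h, one_pow]

lemma scriptL_eq (k : ℕ) : scriptL p (r + 2) χ k = (1 - χ (1 + p)) * LNeg χ k := by
  rw [scriptL]; push_cast; rw [add_comm (p : ZMod (p ^ (r + 2)))]

lemma scriptL_eq_regularizedL_mul {k : ℕ} {a v : ℂ}
    (h : 1 - χ (1 + p) * ((1 + p : ℤ) : ℂ) ^ (k + 1)
      = (1 - χ (1 + p)) * (1 + (1 - χ (1 + p)) * a))
    (hv : (1 + (1 - χ (1 + p)) * a) * v = 1) :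
    scriptL p (r + 2) χ k = regularizedL χ k * v := by
  rw [scriptL_eq, regularizedL, h]
  linear_combination -(1 - χ (1 + p)) * LNeg χ k * hv

/-- Here 𝓛 = E·v, with v the inverse of the unit part of the Euler factor. The change of E is a
multiple of p^(j+1) and goes into `y`. The main term comes from (1 - ζ)(v' - v) = vv'ζ((1+p)^(l+1) -
(1+p)^(k+1)), where vv' ≡ 1 mod 1 - ζ. -/
lemma exists_scriptL_sub_scriptL (hp2 : p ≠ 2) (hχ : χ.IsPrimitive) (k j q : ℕ) :
    ∃ y ∈ 𝒪, (1 - χ (1 + p)) * (scriptL p (r + 2) χ (k + Nat.totient (p ^ (j + 1)) * q)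
      - scriptL p (r + 2) χ k) = p ^ (j + 1) *
        (-(q * χ (1 + p)) * regularizedL χ k + (1 - χ (1 + p)) * y) := by
  have hζm := apply_one_add_mem (χ := χ)
  have hE := regularizedL_mem hχ k
  have hζ1 := χ.apply_one_add_pow_eq_one hp2
  obtain ⟨ρ, hρ, hpρ⟩ := exists_prime_eq_sq_mul hp2 hζ1 (hχ.apply_one_add_pow_ne_one hp2)
  set l := k + Nat.totient (p ^ (j + 1)) * q with hl
  obtain ⟨a, ha, v, hv, hU, hv1⟩ := exists_unit_factor hp2 hζm hζ1 hρ hpρ k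
  obtain ⟨a', ha', v', hv', hU', hv1'⟩ := exists_unit_factor hp2 hζm hζ1 hρ hpρ l
  obtain ⟨g, hg, hEE⟩ := exists_regularizedL_sub hχ
    (fun b hb => prime_pow_dvd_pow_sub_pow hb k (j + 1) q)
  rw [← hl] at hEE
  rw [scriptL_eq_regularizedL_mul hU hv1, scriptL_eq_regularizedL_mul hU' hv1']
  obtain ⟨Y, hY⟩ : ∃ Y : ℤ, (1 + p : ℤ) ^ (l + 1) - (1 + p) ^ (k + 1)
      = p ^ (j + 1) * (-q + p * Y) := by
    obtain ⟨z, hz⟩ := exists_one_add_prime_pow_totient_mul hp2 j q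
    obtain ⟨w, hw⟩ : (p : ℤ) ∣ (1 + p : ℤ) ^ (k + 1) - 1 := by
      have := sub_dvd_pow_sub_pow (1 + p : ℤ) 1 (k + 1)
      rwa [one_pow, add_sub_cancel_left] at this
    refine ⟨z * (1 + p * w) - q * w, ?_⟩
    rw [hl, show k + Nat.totient (p ^ (j + 1)) * q + 1
      = k + 1 + Nat.totient (p ^ (j + 1)) * q by ring, pow_add, hz,
      show (1 + p : ℤ) ^ (k + 1) = 1 + p * w by rw [← hw]; ring]
    ring
  have hYC := congrArg (fun z : ℤ => (z : ℂ)) hY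
  push_cast at hYC hU hU'
  generalize χ (1 + p) = ζ at *
  generalize regularizedL χ k = E at *
  generalize regularizedL χ l = E' at *
  have hπm : 1 - ζ ∈ 𝒪 := sub_mem (one_mem _) hζm
  refine ⟨g * v' + E * v * v' * ζ * Y * ((1 - ζ) * ρ)
      + ζ * q * E * v * v' * (a + a' + (1 - ζ) * a * a'), ?_, ?_⟩
  · have h1 := mul_mem (mul_mem hE hv) hv'
    refine add_mem (add_mem (mul_mem hg hv') ?_) ?_
    · exact mul_mem (mul_mem (mul_mem h1 hζm) (intCast_mem _ _)) (mul_mem hπm hρ)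
    · have := mul_mem (mul_mem (mul_mem hζm (natCast_mem 𝒪 q)) h1)
        (add_mem (add_mem ha ha') (mul_mem (mul_mem hπm ha) ha'))
      convert this using 1; ring
  have e1 : (1 - ζ) * (v' - v) = v * v' * ζ * p ^ (j + 1) * (-q + p * Y) := by
    linear_combination (1 - ζ) * v * hv1' - (1 - ζ) * v' * hv1 + v * v' * ζ * hYC
      + v * v' * hU' - v * v' * hU
  have e2 : 1 - v * v' = v * v' * (1 - ζ) * (a + a' + (1 - ζ) * a * a') := by
    linear_combination -hv1 - (1 + (1 - ζ) * a) * v * hv1'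
  linear_combination (1 - ζ) * v' * hEE + E * e1
    + p ^ (j + 1) * E * v * v' * ζ * Y * hpρ + p ^ (j + 1) * q * ζ * E * e2

/-- Modulo 1 - ζ the unit part of the Euler factor is 1, and Kummer's congruence mod `p` moves d to
d + (p-1)t. This brings the reduced index d into the main term. -/
lemma exists_scriptL_sub_regularizedL (hp2 : p ≠ 2) (hχ : χ.IsPrimitive) (d t : ℕ) :
    ∃ y ∈ 𝒪, scriptL p (r + 2) χ d - regularizedL χ (d + (p - 1) * t) = (1 - χ (1 + p)) * y := by
  have hζm := apply_one_add_mem (χ := χ)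
  have hE := regularizedL_mem hχ d
  have hζ1 := χ.apply_one_add_pow_eq_one hp2
  obtain ⟨ρ, hρ, hpρ⟩ := exists_prime_eq_sq_mul hp2 hζ1 (hχ.apply_one_add_pow_ne_one hp2)
  obtain ⟨a, ha, v, hv, hU, hv1⟩ := exists_unit_factor hp2 hζm hζ1 hρ hpρ d
  obtain ⟨g, hg, hEE⟩ := exists_regularizedL_sub hχ (k := d) (l := d + (p - 1) * t) (n := 1)
    (fun b hb => by
      have := prime_pow_dvd_pow_sub_pow hb d 1 t
      rwa [pow_one p, Nat.totient_prime hp.out] at this)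
  rw [scriptL_eq_regularizedL_mul hU hv1]
  generalize χ (1 + p) = ζ at *
  have hπm : 1 - ζ ∈ 𝒪 := sub_mem (one_mem _) hζm
  refine ⟨-(regularizedL χ d * a * v) - (1 - ζ) * ρ * g,
    sub_mem (neg_mem (mul_mem (mul_mem hE ha) hv)) (mul_mem (mul_mem hπm hρ) hg), ?_⟩
  linear_combination regularizedL χ d * hv1 - hEE - g * hpρ

/-- In the residue field ζ maps to 1, while a Voronoi sum congruent to E mod `p` maps to -1.
Divisibility by 1 - ζ would then give s = 0 in K for the denominator s, although `p ∤ s`. -/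
lemma regularizedL_ne_one_sub_mul (hp2 : p ≠ 2) (hχ : χ.IsPrimitive) (k : ℕ)
    (hno : ∀ a : ℤ, ¬ (p : ℤ) ∣ a →
      ¬ PrimeTo p (1 - χ (a : ZMod (p ^ (r + 2))) * (a : ℂ) ^ (k + 1))) {y : ℂ} (hy : y ∈ 𝒪) :
    regularizedL χ k ≠ (1 - χ (1 + p)) * y := by
  intro hE
  have hζ1 := χ.apply_one_add_pow_eq_one hp2
  have hζm := apply_one_add_mem (χ := χ)
  obtain ⟨ρ, hρ, hpρ⟩ := exists_prime_eq_sq_mul hp2 hζ1 (hχ.apply_one_add_pow_ne_one hp2)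
  obtain ⟨K, _, _, φ, hφ⟩ := exists_field_hom_of_not_primeTo (by omega) hp2 χ k hno
  obtain ⟨M₀, hM⟩ := exists_regularized_sub_voronoiSum χ (hχ.ne_one_of_prime_pow (by omega))
    (not_dvd_one_add (p := p)) k 1
  obtain ⟨z, hz, hV⟩ := hM (M₀ + 1) (by omega)
  set V := voronoiSum χ (1 + p) (p ^ (M₀ + 1)) k with hVdef
  have hE' : (1 - χ ((1 + p : ℤ) : ZMod (p ^ (r + 2))) * ((1 + p : ℤ) : ℂ) ^ (k + 1)) * LNeg χ k
      = regularizedL χ k := by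
    rw [regularizedL]; push_cast; rfl
  rw [hE', hE] at hV
  have hy' : y - (1 - χ (1 + p)) * ρ * z ∈ 𝒪 :=
    sub_mem hy (mul_mem (mul_mem (sub_mem (one_mem _) hζm) hρ) hz)
  have hVy : V = (1 - χ (1 + p)) * (y - (1 - χ (1 + p)) * ρ * z) := by
    linear_combination -hV - z * hpρ
  obtain ⟨s, hs, hsI⟩ := hy'
  let A := integralClosure ℤ ℂ
  let X : ZMod (p ^ (r + 2)) → A := fun a => ⟨χ a, χ.isIntegral_apply _⟩
  let VA : A := ∑ x : ZMod (p ^ (M₀ + 1)), X (((1 + p) * x.val : ℤ) : ZMod (p ^ (r + 2)))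
    * (((1 + p) * x.val : ℤ) : A) ^ k * (((1 + p) * x.val / (p ^ (M₀ + 1) : ℕ) : ℤ) : A)
  have hVA : (VA : ℂ) = V := by
    rw [hVdef, voronoiSum]
    simp only [VA, X]
    push_cast
    rfl
  have hrel : (s : A) * VA = (1 - X (1 + p)) * ⟨_, hsI⟩ := by
    ext
    push_cast
    rw [hVA, hVy]
    simp only [X]
    ring
  have hpK : ((p : ℕ) : K) = 0 := CharP.cast_eq_zero K p
  have hφV : φ VA = -1 := by
    rw [← sum_inv_mul_ediv_eq_neg_one hp2 K M₀]
    simp only [VA, map_sum, map_mul, map_pow, map_intCast]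
    refine Finset.sum_congr rfl fun x _ => ?_
    have := hφ ((1 + p) * x.val)
    rw [show φ (X (((1 + p) * x.val : ℤ) : ZMod (p ^ (r + 2)))) *
      (((1 + p) * x.val : ℤ) : K) ^ k = _ from this]
    congr 2
    push_cast
    rw [hpK]; ring
  have hφζ : φ (X (1 + p)) = 1 := by
    have := hφ (1 + p)
    have h2 : X (1 + p) = ⟨χ ((1 + p : ℤ) : ZMod (p ^ (r + 2))), χ.isIntegral_apply _⟩ := by
      ext; simp [X]
    rw [h2]
    push_cast [hpK] at this
    simpa [hpK] using this
  have hfin := congrArg φ hrel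
  rw [map_mul, map_mul, map_sub, map_one, hφζ, sub_self, zero_mul, hφV, map_natCast, mul_neg,
    mul_one, neg_eq_zero, CharP.cast_eq_zero_iff K p] at hfin
  exact hs hfin

/-- With h = p^j q and `p ∤ q`, the difference is p^(j+1)/(1 - ζ) times an element not divisible by
1 - ζ. It is thus divisible by p^j, as 1 - ζ divides `p`, but not by p^(j+1). -/
lemma congrModPow_scriptL_iff (hp2 : p ≠ 2) (hχ : χ.IsPrimitive) (k : ℕ)
    (hno : ∀ a : ℤ, ¬ (p : ℤ) ∣ a →
      ¬ PrimeTo p (1 - χ (a : ZMod (p ^ (r + 2))) * (a : ℂ) ^ (k + 1))) (N h : ℕ) (hh : h ≠ 0) :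
    CongrModPow p N (scriptL p (r + 2) χ (k + (p - 1) * h)) (scriptL p (r + 2) χ k)
      ↔ p ^ N ∣ h := by
  have hp0 : (p : ℂ) ≠ 0 := by exact_mod_cast hp.out.ne_zero
  have hπ := one_sub_apply_ne_zero hp2 hχ
  have hζm := apply_one_add_mem (χ := χ)
  have hE := regularizedL_mem hχ k
  have hζ1 := χ.apply_one_add_pow_eq_one hp2
  obtain ⟨ρ, hρ, hpρ⟩ := exists_prime_eq_sq_mul hp2 hζ1 (hχ.apply_one_add_pow_ne_one hp2)
  obtain ⟨j, q, hq, rfl⟩ := Nat.exists_eq_pow_mul_and_not_dvd hh p hp.out.ne_one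
  have hl : k + (p - 1) * (p ^ j * q) = k + Nat.totient (p ^ (j + 1)) * q := by
    rw [Nat.totient_prime_pow_succ hp.out]; ring
  rw [hl]
  obtain ⟨y, hy, hΔ⟩ := exists_scriptL_sub_scriptL hp2 hχ k j q
  set Δ := scriptL p (r + 2) χ (k + Nat.totient (p ^ (j + 1)) * q) - scriptL p (r + 2) χ k
  rw [congrModPow_iff]
  rcases le_or_gt N j with hN | hN
  · refine iff_of_true ?_ ((pow_dvd_pow p hN).mul_right q)
    obtain ⟨i, rfl⟩ := Nat.exists_eq_add_of_le hN
    refine ⟨p ^ i * (-(q * χ (1 + p)) * ((1 - χ (1 + p)) * ρ) * regularizedL χ k + p * y), ?_, ?_⟩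
    · refine mul_mem (pow_mem (natCast_mem _ _) _) (add_mem (mul_mem (mul_mem (neg_mem (mul_mem
        (natCast_mem _ _) hζm)) (mul_mem (sub_mem (one_mem _) hζm) hρ)) hE)
        (mul_mem (natCast_mem _ _) hy))
    · apply mul_left_cancel₀ hπ
      rw [hΔ]
      linear_combination -p ^ (N + i) * q * χ (1 + p) * regularizedL χ k * hpρ
  · refine iff_of_false ?_ ?_
    · rintro ⟨z, hz, hΔz⟩
      obtain ⟨i, rfl⟩ := Nat.exists_eq_add_of_le hN
      have hq' : ((q : ℤ) : ℂ)⁻¹ ∈ 𝒪 :=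
        inv_intCast_mem_pIntegralSubring (fun h => hq (Int.natCast_dvd_natCast.mp h))
      have hq0 : (q : ℂ) ≠ 0 := by
        intro h0; exact hq (by rw [Nat.cast_eq_zero.mp h0]; exact dvd_zero _)
      -- ζ^M is the inverse of ζ, used to cancel ζ from qζE.
      obtain ⟨M, hM⟩ := Nat.exists_eq_succ_of_ne_zero (pow_ne_zero (r + 1) hp.out.ne_zero)
      rw [hM, pow_succ] at hζ1
      refine regularizedL_ne_one_sub_mul hp2 hχ k hno
        (y := χ (1 + p) ^ M * ((q : ℤ) : ℂ)⁻¹ * (y - p ^ i * z))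
        (mul_mem (mul_mem (pow_mem hζm _) hq') (sub_mem hy (mul_mem
          (pow_mem (natCast_mem _ _) _) hz))) ?_
      change Δ = _ at hΔz
      rw [hΔz] at hΔ
      have h1 : q * χ (1 + p) * regularizedL χ k = (1 - χ (1 + p)) * (y - p ^ i * z) := by
        apply mul_left_cancel₀ (pow_ne_zero (j + 1) hp0)
        rw [show j.succ + i = j + 1 + i from rfl] at hΔ
        linear_combination hΔ
      push_cast
      field_simp
      linear_combination χ (1 + p) ^ M * h1 - q * regularizedL χ k * hζ1
    · intro h
      have : p ^ j * p ∣ p ^ j * q := by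
        rw [← pow_succ]; exact (pow_dvd_pow p hN).trans h
      exact hq (Nat.dvd_of_mul_dvd_mul_left (pow_pos hp.out.pos j) this)

lemma primeTo_one_sub_of_primeTo {m : ℕ} (χ : DirichletCharacter ℂ (p ^ m)) {a : ℤ}
    (ha : ¬ (p : ℤ) ∣ a) (l t : ℕ) (h : PrimeTo p (1 - χ a * (a : ℂ) ^ (l + 1))) :
    PrimeTo p (1 - χ a * (a : ℂ) ^ (l + (p - 1) * t + 1)) := by
  have h1 := prime_pow_dvd_pow_sub_pow ha l 1 t
  rw [pow_one p, Nat.totient_prime hp.out, pow_one] at h1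
  obtain ⟨w, hw⟩ := h1
  have hwC := congrArg (fun z : ℤ => (z : ℂ)) hw
  push_cast at hwC
  refine h.of_sub_eq_prime_mul (t := -(χ a * a * w))
    ((((χ.isIntegral_apply _).mul (isIntegral_algebraMap (x := a))).mul
      (isIntegral_algebraMap (x := w))).neg) ?_
  rw [pow_succ, pow_succ]
  linear_combination -χ a * a * hwC

end PIntegralSubring

/-! ### Assembly of both cases. -/

theorem theorem1p2 (p m n q k : ℕ) [Fact p.Prime] (hp : Odd p) (hm : 1 ≤ m)
    (hn : 1 ≤ n) (hq : 1 ≤ q) (hpq : ¬ p ∣ q)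
    (χ : DirichletCharacter ℂ (p ^ m)) (hχ : χ.IsPrimitive)
    (hk : χ (-1) ≠ (-1) ^ k) :
    ((∃ a : ℤ, ¬ (p : ℤ) ∣ a ∧
        PrimeTo p (1 - χ (a : ZMod (p ^ m)) * (a : ℂ) ^ (k + 1))) →
      CongrModPow p n (LNeg χ (k + Nat.totient (p ^ n) * q)) (LNeg χ k)) ∧
    (2 ≤ m →
      (∀ a : ℤ, ¬ (p : ℤ) ∣ a →
        ¬ PrimeTo p (1 - χ (a : ZMod (p ^ m)) * (a : ℂ) ^ (k + 1))) →
      (∀ d : ℕ, d < p - 1 → d ≡ k [MOD (p - 1)] →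
        CongrModPow p n
          (scriptL p m χ (k + Nat.totient (p ^ n) * q) - scriptL p m χ k)
          ((p : ℂ) ^ n * (q : ℂ)
            / (1 - (starRingEnd ℂ) (χ ((p + 1 : ℕ) : ZMod (p ^ m))))
            * scriptL p m χ d)) ∧
      (∀ (N l : ℕ) (h : ℤ), (l : ℤ) = (k : ℤ) + ((p : ℤ) - 1) * h →
        (CongrModPow p N (scriptL p m χ l) (scriptL p m χ k) ↔ (p : ℤ) ^ N ∣ h))) := by
  have hp' : Fact p.Prime := inferInstance
  have hp2 : p ≠ 2 := by rintro rfl; exact absurd hp (by decide)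
  refine ⟨?_, fun hm2 hno => ?_⟩
  · rintro ⟨a, ha, hprime⟩
    exact congrModPow_LNeg_of_primeTo (by omega) χ (hχ.ne_one_of_prime_pow (by omega)) ha k n q
      (by omega) hprime
  obtain ⟨r, rfl⟩ : ∃ r, m = r + 2 := ⟨m - 2, by omega⟩
  have hp1 : 1 ≤ p := hp'.out.one_le
  refine ⟨fun d hd hdk => ?_, fun N l h hl => ?_⟩
  · obtain ⟨j, rfl⟩ : ∃ j, n = j + 1 := ⟨n - 1, by omega⟩
    obtain ⟨t, rfl⟩ : ∃ t, k = d + (p - 1) * t := by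
      refine ⟨k / (p - 1), ?_⟩
      have h1 : d = k % (p - 1) := by
        have : d % (p - 1) = k % (p - 1) := hdk
        rwa [Nat.mod_eq_of_lt hd] at this
      rw [h1, Nat.mod_add_div]
    have hπ := one_sub_apply_ne_zero hp2 hχ
    have hζm := apply_one_add_mem (χ := χ)
    have hζ1 := χ.apply_one_add_pow_eq_one hp2
    obtain ⟨y, hy, hΔ⟩ := exists_scriptL_sub_scriptL hp2 hχ (d + (p - 1) * t) j q
    obtain ⟨z, hz, hd⟩ := exists_scriptL_sub_regularizedL hp2 hχ d t
    have hconj : (starRingEnd ℂ) (χ ((p + 1 : ℕ) : ZMod (p ^ (r + 2)))) = (χ (1 + p))⁻¹ := by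
      push_cast
      rw [add_comm (p : ZMod (p ^ (r + 2)))]
      refine (Complex.inv_eq_conj ?_).symm
      exact Complex.norm_eq_one_of_pow_eq_one hζ1 (pow_ne_zero _ hp'.out.ne_zero)
    have hζ0 : χ (1 + p) ≠ 0 := by
      intro h0
      rw [h0, zero_pow (pow_ne_zero _ hp'.out.ne_zero)] at hζ1
      exact zero_ne_one hζ1
    rw [congrModPow_iff, hconj]
    refine ⟨y + q * χ (1 + p) * z, add_mem hy (mul_mem (mul_mem (natCast_mem _ _) hζm) hz), ?_⟩
    apply mul_left_cancel₀ hπ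
    -- Since ζ̄ = ζ⁻¹, one has 1/(1 - ζ̄) = -ζ/(1 - ζ), matching the -qζ of the main term.
    have e1 : (1 - χ (1 + p)) * ((p : ℂ) ^ (j + 1) * q / (1 - (χ (1 + p))⁻¹)
        * scriptL p (r + 2) χ d) = -(p ^ (j + 1) * q * χ (1 + p) * scriptL p (r + 2) χ d) := by
      have h2 : 1 - (χ (1 + p))⁻¹ = -((1 - χ (1 + p)) / χ (1 + p)) := by field_simp; ring
      rw [h2]
      field_simp
    rw [mul_sub, e1]
    linear_combination hΔ + p ^ (j + 1) * q * χ (1 + p) * hd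
  · have hcast : ((p - 1 : ℕ) : ℤ) = p - 1 := by push_cast [Nat.cast_sub hp1]; rfl
    rcases lt_trichotomy h 0 with hneg | rfl | hpos
    · obtain ⟨i, rfl⟩ : ∃ i : ℕ, h = -i := ⟨h.natAbs, by omega⟩
      have hkl : k = l + (p - 1) * i := by
        zify
        rw [hcast]; linear_combination -hl
      subst hkl
      have := congrModPow_scriptL_iff hp2 hχ l
        (fun a ha hpr => hno a ha (primeTo_one_sub_of_primeTo χ ha l i hpr)) N i (by omega)
      rw [dvd_neg, ← Nat.cast_pow, Int.natCast_dvd_natCast, ← this]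
      exact ⟨CongrModPow.symm, CongrModPow.symm⟩
    · have : l = k := by zify; linear_combination hl
      subst this
      refine iff_of_true ?_ (dvd_zero _)
      rw [congrModPow_iff]
      exact ⟨0, zero_mem _, by ring⟩
    · obtain ⟨i, rfl⟩ : ∃ i : ℕ, h = i := ⟨h.natAbs, by omega⟩
      have hkl : l = k + (p - 1) * i := by
        zify
        rw [hcast]; linear_combination hl
      subst hkl
      rw [← Nat.cast_pow, Int.natCast_dvd_natCast]
      exact congrModPow_scriptL_iff hp2 hχ k hno N i (by omega)
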